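/- Let $n\ge 2$, let $\frac12<s<1$, and let $\Omega\subset\mathbb R^n$ be a bounded Lipschitz domain: a bounded open set such that near every point of $\partial\Omega$, in suitable Cartesian coordinates, $\Omega$ is the region above the graph of a Lipschitz function. (Connectedness is not needed.) Functions take values in $\mathbb R$ or in $\mathbb C$, and $dQ$ denotes surface measure on $\partial\Omega$. For $0<\alpha<1$ let $H^\alpha(\partial\Omega)$ be the space of all $\psi\in L^2(\partial\Omega)$ for which $$\|\psi\|_{H^\alpha(\partial\Omega)}^2=\int_{\partial\Omega}|\psi(Q)|^2\,dQ+\int_{\partial\Omega}\int_{\partial\Omega}\frac{|\psi(P)-\psi(Q)|^2}{|P-Q|^{n-1+2\alpha}}\,dP\,dQ$$ is finite. Let $H^{-\alpha}(\partial\Omega)$ be its dual space with the dual norm, and let $\langle\cdot,\cdot\rangle$ be the (bilinear) duality pairing between $H^{-\alpha}(\partial\Omega)$ and $H^{\alpha}(\partial\Omega)$. For an open set $U\subset\mathbb R^n$, $H^s(U)$ is defined in the same way, with Lebesgue measure on $U$ and the exponent $n+2s$ in place of $n-1+2\alpha$. Let $\Gamma_{2s}(x)=c(n,s)\,|x|^{-(n-2s)}$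 be the Riesz kernel of order $2s$, where $c(n,s)>0$ is the normalising constant (its value is immaterial; any positive constant is allowed). Then for every $x\in\mathbb R^n\setminus\partial\Omega$ the function $\Gamma_{2s}(x-\cdot)$ belongs to $H^{s-\frac12}(\partial\Omega)$, so that for $\phi\in H^{-s+\frac12}(\partial\Omega)$ the layer potential $$u(x)=\mathcal S_s\phi(x)=\langle\phi,\Gamma_{2s}(x-\cdot)\rangle,\qquad x\in\mathbb R^n\setminus\partial\Omega,$$ is well defined. Let $R$ be such that $\Omega\subset B_{R/2}$, where $B_r$ is the open ball of radius $r$ centred at the origin. 1. There is a constant $c_R>0$, depending only on $n$, $s$, $\Omega$, $R$ (and the normalising constant $c(n,s)$), such that for all $\phi\in H^{-s+\frac12}(\partial\Omega)$ one has $u=\mathcal S_s\phi\in H^s(B_R)$ and $$\|u\|_{H^s(B_R)}\le c_R\,\|\phi\|_{H^{-s+\frac12}(\partial\Omega)}.$$ 2. For all $\phi\in H^{-s+\frac12}(\partial\Omega)$ and all $F\in C_c^\infty(B_R)$, $Fu$ is integrable on $B_R$, $F\,\Gamma_{2s}(\cdot-Q)$ is integrable on $B_R$ for every $Q\in\partial\Omega$,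 the function $Q\mapsto\int_{B_R}F(x)\,\Gamma_{2s}(x-Q)\,dx$ belongs to $H^{s-\frac12}(\partial\Omega)$, and $$\int_{B_R}F(x)\,u(x)\,dx=\Big\langle\phi,\int_{B_R}F(x)\,\Gamma_{2s}(x-\cdot)\,dx\Big\rangle .$$ -/

import Mathlib

open MeasureTheory Metric Set
open scoped ContDiff NNReal ENNReal

noncomputable section

namespace FracLayer

variable {E : Type*} [NormedAddCommGroup E] [MeasurableSpace E]
variable {𝕜 : Type*} [RCLike 𝕜]

/-! ### Fractional Sobolev spaces of order `α` over a `d`-dimensional measure -/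

/-- The Gagliardo difference quotient `(f x - f y) / |x - y| ^ ((d + 2 α) / 2)`. -/
def diffQuot (d α : ℝ) (f : E → 𝕜) (p : E × E) : 𝕜 :=
  (‖p.1 - p.2‖ ^ ((d + 2 * α) / 2))⁻¹ • (f p.1 - f p.2)

/-- Almost everywhere equal functions have almost everywhere equal difference quotients. The
product measure is not assumed to be s-finite here. -/
theorem diffQuot_congr {μ : Measure E} (d α : ℝ) {f g : E → 𝕜} (h : f =ᵐ[μ] g) :
    diffQuot d α f =ᵐ[μ.prod μ] diffQuot d α g := by
  have key : ∀ᵐ p ∂(μ.prod μ), f p.1 = g p.1 ∧ f p.2 = g p.2 := by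
    obtain ⟨t, hsub, ht, h0⟩ := exists_measurable_superset_of_null (ae_iff.1 h)
    have hfst : (μ.prod μ) (Prod.fst ⁻¹' t) = 0 := by
      refine le_antisymm ((Measure.prod_apply_le (measurable_fst ht)).trans_eq ?_) zero_le
      rw [lintegral_eq_zero_of_ae_eq_zero]
      filter_upwards [measure_eq_zero_iff_ae_notMem.1 h0] with x hx
      simp [preimage_preimage, hx]
    have hsnd : (μ.prod μ) (Prod.snd ⁻¹' t) = 0 := by
      refine le_antisymm ((Measure.prod_apply_le (measurable_snd ht)).trans_eq ?_) zero_le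
      simp [preimage_preimage, h0]
    filter_upwards [measure_eq_zero_iff_ae_notMem.1 hfst,
      measure_eq_zero_iff_ae_notMem.1 hsnd] with p h1 h2
    exact ⟨by_contra fun hc => h1 (hsub hc), by_contra fun hc => h2 (hsub hc)⟩
  filter_upwards [key] with p hp
  simp [diffQuot, hp.1, hp.2]

/-- The space `H^α(μ)` of all `f ∈ L²(μ)` with
`∬ |f x - f y|² / |x - y| ^ (d + 2 α) dμ(x) dμ(y) < ∞`, where `d` is the dimension of the
measure `μ`. It is realised as the graph of `f ↦ diffQuot d α f` in `L²(μ) × L²(μ × μ)`, so that it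
carries the norm `(‖f‖²_{L²(μ)} + ∬ |f x - f y|² / |x - y| ^ (d + 2 α) dμ(x) dμ(y)) ^ (1/2)`. -/
def FracSobolev (𝕜 : Type*) [RCLike 𝕜] (μ : Measure E) (d α : ℝ) :
    Submodule 𝕜 (WithLp 2 (Lp 𝕜 2 μ × Lp 𝕜 2 (μ.prod μ))) where
  carrier := {w | w.snd =ᵐ[μ.prod μ] diffQuot d α w.fst}
  zero_mem' := by
    have h1 := diffQuot_congr (𝕜 := 𝕜) d α (Lp.coeFn_zero 𝕜 2 μ)
    have h2 := Lp.coeFn_zero 𝕜 2 (μ.prod μ)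
    filter_upwards [h1, h2] with p h1 h2
    simp only [WithLp.zero_snd, WithLp.zero_fst]
    rw [h1, h2]
    simp [diffQuot]
  add_mem' := by
    intro v w hv hw
    change _ =ᵐ[μ.prod μ] _
    have h1 := diffQuot_congr d α (Lp.coeFn_add v.fst w.fst)
    have h2 := Lp.coeFn_add v.snd w.snd
    filter_upwards [h1, h2, hv, hw] with p h1 h2 hv hw
    simp only [WithLp.add_snd, WithLp.add_fst]
    rw [h1, h2]
    simp only [Pi.add_apply, hv, hw, diffQuot, ← smul_add]
    congr 1
    ring
  smul_mem' := by
    intro c v hv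
    change _ =ᵐ[μ.prod μ] _
    have h1 := diffQuot_congr d α (Lp.coeFn_smul c v.fst)
    have h2 := Lp.coeFn_smul c v.snd
    filter_upwards [h1, h2, hv] with p h1 h2 hv
    simp only [WithLp.smul_snd, WithLp.smul_fst]
    rw [h1, h2]
    simp only [Pi.smul_apply, hv, diffQuot, ← smul_sub]
    rw [smul_comm]

/-- The function `f` represents an element of `H^α(μ)`. -/
def MemFracSobolev (μ : Measure E) (d α : ℝ) (f : E → 𝕜) : Prop :=
  MemLp f 2 μ ∧ MemLp (diffQuot d α f) 2 (μ.prod μ)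

/-- The element of `H^α(μ)` represented by the function `f`. -/
def MemFracSobolev.toSobolev {μ : Measure E} {d α : ℝ} {f : E → 𝕜}
    (h : MemFracSobolev μ d α f) : FracSobolev 𝕜 μ d α :=
  ⟨WithLp.toLp 2 (h.1.toLp f, h.2.toLp (diffQuot d α f)), by
    change h.2.toLp (diffQuot d α f) =ᵐ[μ.prod μ] diffQuot d α (h.1.toLp f)
    exact h.2.coeFn_toLp.trans (diffQuot_congr d α h.1.coeFn_toLp.symm)⟩

/-- Every element of `H^α(μ)` is represented by a function. -/
theorem exists_rep {μ : Measure E} {d α : ℝ} (w : FracSobolev 𝕜 μ d α) :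
    ∃ (f : E → 𝕜) (h : MemFracSobolev μ d α f), h.toSobolev = w := by
  obtain ⟨w, hw⟩ := w
  change _ =ᵐ[μ.prod μ] _ at hw
  have h2 : MemLp (diffQuot d α w.fst) 2 (μ.prod μ) := (memLp_congr_ae hw).1 (Lp.memLp w.snd)
  refine ⟨w.fst, ⟨Lp.memLp w.fst, h2⟩, Subtype.ext ?_⟩
  refine (WithLp.equiv 2 _).injective (Prod.ext (Lp.toLp_coeFn _ (Lp.memLp w.fst)) ?_)
  exact Lp.ext (h2.coeFn_toLp.trans hw.symm)

/-- The norm of `H^α(μ)` is the Gagliardo norm. -/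
theorem norm_toSobolev_sq {μ : Measure E} {d α : ℝ} {f : E → 𝕜} (h : MemFracSobolev μ d α f) :
    ‖h.toSobolev‖ ^ 2 = ∫ x, ‖f x‖ ^ 2 ∂μ
      + ∫ p, ‖f p.1 - f p.2‖ ^ 2 / ‖p.1 - p.2‖ ^ (d + 2 * α) ∂(μ.prod μ) := by
  have aux : ∀ {X : Type _} [MeasurableSpace X] {ν : Measure X} {g : X → 𝕜} (hg : MemLp g 2 ν),
      ‖hg.toLp g‖ ^ 2 = ∫ x, ‖g x‖ ^ 2 ∂ν := by
    intro X _ ν g hg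
    rw [Lp.norm_toLp, hg.eLpNorm_eq_integral_rpow_norm (by simp) (by simp)]
    have h0 : 0 ≤ ∫ x, ‖g x‖ ^ (2 : ℝ) ∂ν := integral_nonneg fun x => by positivity
    rw [ENNReal.toReal_ofReal (by simp only [ENNReal.toReal_ofNat]; positivity)]
    simp only [ENNReal.toReal_ofNat]
    rw [← Real.rpow_natCast, ← Real.rpow_mul h0]
    norm_num
  have e : ‖h.toSobolev‖ ^ 2
      = ‖h.1.toLp f‖ ^ 2 + ‖h.2.toLp (diffQuot d α f)‖ ^ 2 :=
    WithLp.prod_norm_sq_eq_of_L2 _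
  rw [e, aux, aux]
  congr 2
  funext p
  have : (‖p.1 - p.2‖ ^ ((d + 2 * α) / 2)) ^ 2 = ‖p.1 - p.2‖ ^ (d + 2 * α) := by
    rw [← Real.rpow_natCast, ← Real.rpow_mul (norm_nonneg _)]
    norm_num
  rw [diffQuot, norm_smul, mul_pow, norm_inv, Real.norm_of_nonneg (by positivity), inv_pow, this]
  ring

/-! ### Lipschitz domains and the spaces on the boundary -/

/-- `Ω` is a bounded open set with Lipschitz boundary: near each boundary point, `Ω` is, in
suitable Cartesian coordinates (`ν` being the last coordinate direction), the set of points
lying above the graph of a Lipschitz function. Connectedness is not needed. -/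
structure IsBoundedLipschitz {n : ℕ} (Ω : Set (EuclideanSpace ℝ (Fin n))) : Prop where
  isOpen : IsOpen Ω
  isBounded : Bornology.IsBounded Ω
  graph : ∀ P ∈ frontier Ω, ∃ (ν : EuclideanSpace ℝ (Fin n)) (K : ℝ≥0)
    (g : (Submodule.span ℝ {ν})ᗮ → ℝ) (r : ℝ), ‖ν‖ = 1 ∧ LipschitzWith K g ∧ 0 < r ∧
      ∀ x ∈ ball P r,
        (x ∈ Ω ↔ g ((Submodule.span ℝ {ν})ᗮ.orthogonalProjectionOnto x) < inner ℝ ν x)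

/-- The surface measure on `∂Ω`: the `(n-1)`-dimensional Hausdorff measure, normalised so as to
agree with Lebesgue measure on `(n-1)`-dimensional Euclidean spaces. -/
def surfaceMeasure {n : ℕ} (Ω : Set (EuclideanSpace ℝ (Fin n))) :
    Measure (EuclideanSpace ℝ (Fin n)) :=
  (Measure.euclideanHausdorffMeasure (n - 1)).restrict (frontier Ω)

/-- The space `H^α(∂Ω)`. -/
abbrev HBdry (𝕜 : Type*) [RCLike 𝕜] {n : ℕ} (Ω : Set (EuclideanSpace ℝ (Fin n))) (α : ℝ) :=
  FracSobolev 𝕜 (surfaceMeasure Ω) ((n : ℝ) - 1) α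

/-- The function `f` represents an element of `H^α(∂Ω)`. -/
abbrev MemHBdry {n : ℕ} (Ω : Set (EuclideanSpace ℝ (Fin n))) (α : ℝ)
    (f : EuclideanSpace ℝ (Fin n) → 𝕜) : Prop :=
  MemFracSobolev (surfaceMeasure Ω) ((n : ℝ) - 1) α f

/-- The space `H^{-α}(∂Ω)`, the dual space of `H^α(∂Ω)` with the dual norm. The duality pairing
`⟨φ, ψ⟩` is `φ ψ`; it is bilinear. -/
abbrev HBdryDual (𝕜 : Type*) [RCLike 𝕜] {n : ℕ} (Ω : Set (EuclideanSpace ℝ (Fin n))) (α : ℝ) :=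
  HBdry 𝕜 Ω α →L[𝕜] 𝕜

/-- The restriction of the function `f` to the open set `U` represents an element of `H^α(U)`. -/
abbrev MemHOn {n : ℕ} (U : Set (EuclideanSpace ℝ (Fin n))) (α : ℝ)
    (f : EuclideanSpace ℝ (Fin n) → 𝕜) : Prop :=
  MemFracSobolev (volume.restrict U) (n : ℝ) α f

/-! ### The layer potential -/

/-- The Riesz kernel `κ / |x| ^ (n - 2 s)` of order `2 s`, with normalising constant `κ`. -/
def rieszKernel {n : ℕ} (κ s : ℝ) (x : EuclideanSpace ℝ (Fin n)) : ℝ :=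
  κ / ‖x‖ ^ ((n : ℝ) - 2 * s)

open Classical in
/-- The layer potential `x ↦ ⟨φ, Γ_{2s}(x - ·)⟩` of `φ ∈ H^{-α}(∂Ω)`. It is meaningful for
`x ∉ ∂Ω`, where `Γ_{2s}(x - ·)` belongs to `H^α(∂Ω)`; elsewhere the value `0` is a convention. -/
def layerPotential {n : ℕ} (κ s : ℝ) (Ω : Set (EuclideanSpace ℝ (Fin n))) (α : ℝ)
    (φ : HBdryDual 𝕜 Ω α) (x : EuclideanSpace ℝ (Fin n)) : 𝕜 :=
  if h : MemHBdry Ω α (fun Q => ((rieszKernel κ s (x - Q) : ℝ) : 𝕜)) then φ h.toSobolev else 0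

end FracLayer

end

/-!
The only geometric facts used about the boundary are that surface measure `μ` is finite and upper
regular of dimension `n - 1` (`upperRegular_surfaceMeasure`: finitely many charts cover `∂Ω`, and in
each of them `∂Ω` is a Lipschitz image of a piece of a hyperplane), and that `∂Ω` is Lebesgue null.

By Hahn-Banach and Riesz, a functional `φ` on `H^α(∂Ω)`, `α = s - 1/2`, is a pairing with a pair of
densities `(w, W) ∈ L²(μ) × L²(μ × μ)` (`exists_dual_rep`), so the layer potential is
`u(x) = ∫ w(Q) Γ(x - Q) + ∬ W(P, Q) (Γ(x - P) - Γ(x - Q)) / |P - Q| ^ ((n - 1 + 2 α) / 2)`.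
The norm estimate therefore says that four integral operators are bounded on `L²`, whose kernels are
`Γ(x - Q)` and its difference quotients in `x`, in `Q`, and in both (`exists_norm_toSobolev_le`).

The Fourier transform is not needed: although the operator with difference quotients in both
variables is scale invariant, its kernel is absolutely bounded, because the boundary has codimension
one. Write `r = |x - y|`, `t = |P - Q|` and let `ρ` be the least of the four distances between
`x, y` and `P, Q`. The second difference of `Γ` is at most a constant times
`ρ ^ (2 s - n) min(1, r / ρ) min(1, t / ρ)` (`exists_abs_second_difference_le`), so the squared kernel
is at most `ρ ^ (1 - 2 n) r ^ (-n) t ^ (1 - n)` times factors decaying geometrically as `r / ρ` or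
`t / ρ` tends to `0` or `∞`. Schur's test (`boundedKernel_of_sq_le`) asks to split this into a factor
integrable in `(x, y)` and one integrable in `(P, Q)`. The splitting uses the weight
`U(x) = ∫ |x - Q| ^ (1/2 - n) dμ(Q)`, which makes `|x - P| ^ (1/2 - n) / U(x)` integrable in `P`
trivially, while `U dx` is upper regular of dimension `n - 1/2`
(`IsLayerPair.upperRegular_withDensity_weight`). Every integral that arises is then of the kind
bounded in `UpperRegular.lintegral_radialKernel_le`. The other three kernels are subcritical.

The duality identity is Fubini's theorem applied to the formula for `u`; the exchange is licensed by
the same boundedness, and the volume potential of `F` is Lipschitz on `∂Ω` since `∇Γ` is locally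
integrable, hence belongs to `H^α(∂Ω)`.
-/

namespace FracLayer

/-! ### Upper regular measures and radial kernels -/

section Radial

variable {E : Type*} [NormedAddCommGroup E] [MeasurableSpace E]

/-- The measure `ν` is upper regular of dimension `d`: balls of radius `r`, with arbitrary centre,
have measure at most a constant times `r ^ d`. -/
def UpperRegular (ν : Measure E) (d : ℝ) : Prop :=
  ∃ C : ℝ≥0∞, C ≠ ⊤ ∧ ∀ (z : E) (r : ℝ), 0 < r → ν (ball z r) ≤ C * ENNReal.ofReal (r ^ d)

theorem UpperRegular.mono {ν ν' : Measure E} {d : ℝ} (h : UpperRegular ν d) (hle : ν' ≤ ν) :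
    UpperRegular ν' d := by
  obtain ⟨C, hC, hb⟩ := h
  exact ⟨C, hC, fun z r hr => (hle _).trans (hb z r hr)⟩

/-- The critical power `τ ^ (-d)`, damped by `(τ / ρ) ^ p` for `τ ≤ ρ` and by `(ρ / τ) ^ q` for
`τ ≥ ρ`. Its integral in `τ = |x - z|` against a `d`-dimensional measure is bounded uniformly in the
scale `ρ` and the centre `z`. -/
noncomputable def radialKernel (d p q τ ρ : ℝ) : ℝ :=
  τ ^ (-d) * min ((τ / ρ) ^ p) ((ρ / τ) ^ q)

theorem radialKernel_nonneg {d p q τ ρ : ℝ} (hτ : 0 ≤ τ) (hρ : 0 ≤ ρ) :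
    0 ≤ radialKernel d p q τ ρ := by
  unfold radialKernel; positivity

@[fun_prop]
theorem measurable_radialKernel {X : Type*} [MeasurableSpace X] (d p q : ℝ) {f g : X → ℝ}
    (hf : Measurable f) (hg : Measurable g) :
    Measurable fun x => radialKernel d p q (f x) (g x) := by
  unfold radialKernel
  exact (hf.pow_const _).mul (((hf.div hg).pow_const _).min ((hg.div hf).pow_const _))

/-- The dyadic coefficients bounding `radialKernel`. -/
theorem summable_dyadic {p q : ℝ} (hp : 0 < p) (hq : 0 < q) :
    Summable fun k : ℤ => min (((2 : ℝ) ^ ((k : ℝ) + 1)) ^ p) (((2 : ℝ) ^ (-(k : ℝ))) ^ q) := by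
  have geo : ∀ {a : ℝ}, 0 < a → Summable fun n : ℕ => ((2 : ℝ) ^ (-a)) ^ n := fun {a} ha =>
    summable_geometric_of_lt_one (by positivity)
      (Real.rpow_lt_one_of_one_lt_of_neg (by norm_num) (by linarith))
  refine Summable.of_nat_of_neg ?_ ?_
  · refine Summable.of_nonneg_of_le (fun n => by positivity) (fun n => ?_) (geo hq)
    refine (min_le_right _ _).trans (le_of_eq ?_)
    rw [← Real.rpow_mul (by norm_num), ← Real.rpow_natCast, ← Real.rpow_mul (by norm_num)]
    congr 1; push_cast; ring
  · refine Summable.of_nonneg_of_le (fun n => by positivity) (fun n => ?_)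
      ((geo hp).mul_left ((2 : ℝ) ^ p))
    refine (min_le_left _ _).trans (le_of_eq ?_)
    rw [← Real.rpow_mul (by norm_num), ← Real.rpow_natCast, ← Real.rpow_mul (by norm_num),
      ← Real.rpow_add (by norm_num)]
    congr 1; push_cast; ring

/-- The radial kernels have integrals bounded uniformly in centre and scale: each dyadic annulus
contributes a bounded amount, decaying geometrically away from the scale `ρ`. -/
theorem UpperRegular.lintegral_radialKernel_le [OpensMeasurableSpace E]
    {ν : Measure E} {d p q : ℝ} (hd : 0 ≤ d) (h : UpperRegular ν d) (hp : 0 < p) (hq : 0 < q) :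
    ∃ C : ℝ≥0∞, C ≠ ⊤ ∧ ∀ (z : E) (ρ : ℝ), 0 ≤ ρ →
      ∫⁻ x, ENNReal.ofReal (radialKernel d p q ‖x - z‖ ρ) ∂ν ≤ C := by
  obtain ⟨C, hC, hb⟩ := h
  set c : ℤ → ℝ := fun k => min (((2 : ℝ) ^ ((k : ℝ) + 1)) ^ p) (((2 : ℝ) ^ (-(k : ℝ))) ^ q)
  have hc0 : ∀ k, 0 ≤ c k := fun k => by positivity
  have hc : Summable c := summable_dyadic hp hq
  refine ⟨C * ENNReal.ofReal (2 ^ d) * ∑' k, ENNReal.ofReal (c k), ?_, fun z ρ hρ => ?_⟩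
  · exact ENNReal.mul_ne_top (ENNReal.mul_ne_top hC ENNReal.ofReal_ne_top)
      hc.tsum_ofReal_ne_top
  -- at the scale `0` the kernel vanishes, by the convention on division by zero
  rcases hρ.eq_or_lt with rfl | hρ
  · have : ∀ τ : ℝ, 0 ≤ τ → radialKernel d p q τ 0 = 0 := fun τ hτ => by
      simp [radialKernel, Real.zero_rpow hp.ne', Real.zero_rpow hq.ne']
    simp [this]
  have hpt : ∀ x, ENNReal.ofReal (radialKernel d p q ‖x - z‖ ρ) ≤
      ∑' k : ℤ, (ball z ((2 : ℝ) ^ ((k : ℝ) + 1) * ρ)).indicator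
        (fun _ => ENNReal.ofReal (((2 : ℝ) ^ (k : ℝ) * ρ) ^ (-d) * c k)) x := by
    intro x
    rcases (norm_nonneg (x - z)).eq_or_lt with h0 | h0
    · rw [radialKernel, ← h0]
      simp [Real.zero_rpow hp.ne', Real.zero_rpow hq.ne']
    obtain ⟨k, hk1, hk2⟩ := exists_mem_Ico_zpow (div_pos h0 hρ) (one_lt_two (α := ℝ))
    rw [← Real.rpow_intCast] at hk1 hk2
    push_cast at hk2
    have hk1' := (le_div_iff₀ hρ).1 hk1
    refine le_trans ?_ (ENNReal.le_tsum k)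
    rw [indicator_of_mem (by rw [mem_ball, dist_eq_norm]; exact (div_lt_iff₀ hρ).1 hk2)]
    refine ENNReal.ofReal_le_ofReal ?_
    refine mul_le_mul ?_ (min_le_min ?_ ?_) (by positivity) (by positivity)
    · exact Real.rpow_le_rpow_of_nonpos (by positivity) hk1' (by linarith)
    · exact Real.rpow_le_rpow (by positivity) hk2.le hp.le
    · refine Real.rpow_le_rpow (by positivity) ?_ hq.le
      rw [Real.rpow_neg (by norm_num), ← inv_div]
      exact inv_anti₀ (by positivity) hk1
  refine (lintegral_mono hpt).trans ?_
  rw [lintegral_tsum (fun k => (measurable_const.indicator measurableSet_ball).aemeasurable),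
    ← ENNReal.tsum_mul_left]
  refine ENNReal.tsum_le_tsum fun k => ?_
  rw [lintegral_indicator_const measurableSet_ball]
  have hk : (0 : ℝ) < 2 ^ (k : ℝ) * ρ := by positivity
  refine (mul_le_mul_right (hb z _ (by positivity)) _).trans (le_of_eq ?_)
  have : ((2 : ℝ) ^ ((k : ℝ) + 1) * ρ) ^ d = 2 ^ d * (2 ^ (k : ℝ) * ρ) ^ d := by
    rw [Real.rpow_add (by norm_num), Real.rpow_one, ← Real.mul_rpow (by norm_num) hk.le]
    congr 1; ring
  rw [this, ENNReal.ofReal_mul (by positivity), ENNReal.ofReal_mul (by positivity)]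
  have e : ENNReal.ofReal ((2 ^ (k : ℝ) * ρ) ^ (-d)) * ENNReal.ofReal ((2 ^ (k : ℝ) * ρ) ^ d)
      = 1 := by
    rw [← ENNReal.ofReal_mul (by positivity), ← Real.rpow_add hk]
    simp
  calc _ = C * ENNReal.ofReal (2 ^ d) * ENNReal.ofReal (c k) *
        (ENNReal.ofReal ((2 ^ (k : ℝ) * ρ) ^ (-d)) *
          ENNReal.ofReal ((2 ^ (k : ℝ) * ρ) ^ d)) := by ring
    _ = _ := by rw [e, mul_one]

/-- Powers below the critical one have integrals over balls of the size dictated by scaling. The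
exponent `0` is excluded because of the value of `0 ^ 0`. -/
theorem UpperRegular.lintegral_ball_rpow_le [OpensMeasurableSpace E]
    {ν : Measure E} {d e : ℝ} (hd : 0 ≤ d) (h : UpperRegular ν d) (he : 0 < e + d) (he0 : e ≠ 0) :
    ∃ C : ℝ≥0∞, C ≠ ⊤ ∧ ∀ (z : E) (D : ℝ), 0 < D →
      ∫⁻ x in ball z D, ENNReal.ofReal (‖x - z‖ ^ e) ∂ν ≤ C * ENNReal.ofReal (D ^ (e + d)) := by
  obtain ⟨C, hC, hb⟩ := h.lintegral_radialKernel_le hd he zero_lt_one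
  refine ⟨C, hC, fun z D hD => ?_⟩
  rw [mul_comm]
  refine le_trans ?_ (mul_le_mul_right (hb z D hD.le) _)
  rw [← lintegral_const_mul' _ _ ENNReal.ofReal_ne_top]
  refine le_trans (setLIntegral_mono_ae' measurableSet_ball (ae_of_all _ fun x hx => ?_))
    (setLIntegral_le_lintegral (ball z D) _)
  rw [mem_ball, dist_eq_norm] at hx
  rw [← ENNReal.ofReal_mul (by positivity)]
  refine ENNReal.ofReal_le_ofReal ?_
  rcases (norm_nonneg (x - z)).eq_or_lt with h0 | h0
  · rw [← h0, Real.zero_rpow he0]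
    exact mul_nonneg (by positivity) (radialKernel_nonneg le_rfl hD.le)
  have h1 : (‖x - z‖ / D) ^ (e + d) ≤ (D / ‖x - z‖) ^ (1 : ℝ) :=
    (Real.rpow_le_one (by positivity) ((div_le_one hD).2 hx.le) he.le).trans
      (Real.one_le_rpow ((one_le_div h0).2 hx.le) zero_le_one)
  rw [radialKernel, min_eq_left h1, Real.div_rpow h0.le hD.le]
  have h2 : ‖x - z‖ ^ e = ‖x - z‖ ^ (-d) * ‖x - z‖ ^ (e + d) := by
    rw [← Real.rpow_add h0]; congr 1; ring
  have := (Real.rpow_pos_of_pos hD (e + d)).ne'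
  rw [h2]
  apply le_of_eq
  field_simp

/-- Powers below the critical one are integrable over bounded sets, uniformly in the centre. -/
theorem UpperRegular.lintegral_rpow_le [OpensMeasurableSpace E]
    {ν : Measure E} {d e : ℝ} (hd : 0 ≤ d) (h : UpperRegular ν d) (he : 0 < e + d) (he0 : e ≠ 0)
    (D : ℝ) :
    ∃ C : ℝ≥0∞, C ≠ ⊤ ∧ ∀ (z : E), (∀ᵐ x ∂ν, ‖x - z‖ ≤ D) →
      ∫⁻ x, ENNReal.ofReal (‖x - z‖ ^ e) ∂ν ≤ C := by
  obtain ⟨C, hC, hb⟩ := h.lintegral_ball_rpow_le hd he he0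
  refine ⟨C * ENNReal.ofReal ((|D| + 1) ^ (e + d)),
    ENNReal.mul_ne_top hC ENNReal.ofReal_ne_top, fun z hz => ?_⟩
  refine le_trans (le_of_eq ?_) (hb z (|D| + 1) (by positivity))
  rw [Measure.restrict_eq_self_of_ae_mem]
  filter_upwards [hz] with x hx
  rw [mem_ball, dist_eq_norm]
  linarith [le_abs_self D]

end Radial

/-! ### Surface measure on a Lipschitz boundary -/

section Geometry

variable {n : ℕ}

/-- Lebesgue measure is upper regular of the full dimension. -/
theorem upperRegular_volume : UpperRegular (volume : Measure (EuclideanSpace ℝ (Fin n))) n := by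
  refine ⟨volume (ball (0 : EuclideanSpace ℝ (Fin n)) 1), measure_ball_lt_top.ne, fun z r hr => ?_⟩
  rw [Measure.addHaar_ball_of_pos volume z hr, finrank_euclideanSpace_fin, Real.rpow_natCast, mul_comm]

/-- The part of the boundary seen in a Lipschitz chart lies on the graph of the chart. -/
theorem eq_graph_of_mem_frontier {Ω : Set (EuclideanSpace ℝ (Fin n))} (hΩ : IsOpen Ω) {P ν : EuclideanSpace ℝ (Fin n)} {K : ℝ≥0}
    {g : (Submodule.span ℝ {ν})ᗮ → ℝ} {r : ℝ} (hν : ‖ν‖ = 1) (hg : LipschitzWith K g)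
    (h : ∀ x ∈ ball P r,
        (x ∈ Ω ↔ g ((Submodule.span ℝ {ν})ᗮ.orthogonalProjectionOnto x) < inner ℝ ν x))
    {x : EuclideanSpace ℝ (Fin n)} (hx : x ∈ frontier Ω) (hxP : x ∈ ball P r) :
    x = ((Submodule.span ℝ {ν})ᗮ.orthogonalProjectionOnto x : EuclideanSpace ℝ (Fin n))
      + g ((Submodule.span ℝ {ν})ᗮ.orthogonalProjectionOnto x) • ν := by
  have hcont : Continuous fun y : EuclideanSpace ℝ (Fin n) =>
      g ((Submodule.span ℝ {ν})ᗮ.orthogonalProjectionOnto y) :=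
    hg.continuous.comp (ContinuousLinearMap.continuous _)
  have hxΩ : x ∉ Ω := by
    rw [hΩ.frontier_eq] at hx
    exact hx.2
  have h1 : inner ℝ ν x ≤ g ((Submodule.span ℝ {ν})ᗮ.orthogonalProjectionOnto x) :=
    not_lt.1 fun hlt => hxΩ ((h x hxP).2 hlt)
  have h2 : g ((Submodule.span ℝ {ν})ᗮ.orthogonalProjectionOnto x) ≤ inner ℝ ν x := by
    by_contra! hlt
    have hcl : x ∈ closure Ω := frontier_subset_closure hx
    rw [_root_.mem_closure_iff] at hcl
    have hopen : IsOpen (ball P r ∩ {y : EuclideanSpace ℝ (Fin n) | inner ℝ ν y <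
        g ((Submodule.span ℝ {ν})ᗮ.orthogonalProjectionOnto y)}) :=
      isOpen_ball.inter (isOpen_lt (by fun_prop) hcont)
    obtain ⟨y, ⟨hy1, hy2⟩, hy3⟩ := hcl _ hopen ⟨hxP, hlt⟩
    exact lt_asymm hy2 ((h y hy1).1 hy3)
  rw [le_antisymm h2 h1]
  have hs := (Submodule.span ℝ {ν}).starProjection_add_starProjection_orthogonal x
  rw [Submodule.starProjection_unit_singleton ℝ hν] at hs
  nth_rewrite 1 [← hs]
  rw [add_comm]
  rfl

/-- Near each of its points, the boundary is upper regular of dimension `n - 1`. -/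
theorem exists_ball_surfaceMeasure_le {Ω : Set (EuclideanSpace ℝ (Fin n))} (hΩ : IsBoundedLipschitz Ω) (hn : 1 ≤ n)
    {P : EuclideanSpace ℝ (Fin n)} (hP : P ∈ frontier Ω) :
    ∃ (r : ℝ) (C : ℝ≥0∞), 0 < r ∧ C ≠ ⊤ ∧ ∀ (z : EuclideanSpace ℝ (Fin n)) (t : ℝ), 0 < t →
      surfaceMeasure Ω (ball P r ∩ ball z t) ≤ C * ENNReal.ofReal (t ^ ((n : ℝ) - 1)) := by
  obtain ⟨ν, K, g, r, hν, hg, hr, h⟩ := hΩ.graph P hP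
  have hfin : Module.finrank ℝ (Submodule.span ℝ {ν})ᗮ = n - 1 := by
    have h1 : Module.finrank ℝ (Submodule.span ℝ {ν}) = 1 :=
      finrank_span_singleton (by rintro rfl; simp at hν)
    have h2 := Submodule.finrank_add_finrank_orthogonal (Submodule.span ℝ {ν})
    rw [finrank_euclideanSpace_fin, h1] at h2
    omega
  set G : (Submodule.span ℝ {ν})ᗮ → EuclideanSpace ℝ (Fin n) := fun v => (v : EuclideanSpace ℝ (Fin n)) + g v • ν
  have hG : LipschitzWith (1 + K) G := by
    refine (LipschitzWith.subtype_val _).add ?_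
    refine LipschitzWith.of_dist_le_mul fun a b => ?_
    rw [dist_eq_norm, ← sub_smul, norm_smul, hν, mul_one, ← dist_eq_norm]
    exact hg.dist_le_mul a b
  refine ⟨r, (1 + K : ℝ≥0) ^ ((n - 1 : ℕ) : ℝ) * volume (ball (0 : (Submodule.span ℝ {ν})ᗮ) 1), hr,
    ENNReal.mul_ne_top (ENNReal.rpow_ne_top_of_nonneg (by positivity) ENNReal.coe_ne_top)
      measure_ball_lt_top.ne, fun z t ht => ?_⟩
  set B : Set (Submodule.span ℝ {ν})ᗮ := ball ((Submodule.span ℝ {ν})ᗮ.orthogonalProjectionOnto z) t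
  have hsub : (ball P r ∩ ball z t) ∩ frontier Ω ⊆ G '' B := by
    rintro x ⟨⟨hx1, hx2⟩, hx3⟩
    refine ⟨(Submodule.span ℝ {ν})ᗮ.orthogonalProjectionOnto x, ?_,
      (eq_graph_of_mem_frontier hΩ.isOpen hν hg h hx3 hx1).symm⟩
    rw [mem_ball, dist_eq_norm, ← map_sub]
    rw [mem_ball, dist_eq_norm] at hx2
    exact ((Submodule.span ℝ {ν})ᗮ.norm_orthogonalProjectionOnto_apply_le _).trans_lt hx2
  rw [surfaceMeasure, Measure.restrict_apply (measurableSet_ball.inter measurableSet_ball)]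
  refine (measure_mono hsub).trans ?_
  have hvol : volume B = ENNReal.ofReal (t ^ ((n : ℝ) - 1)) * volume (ball (0 : (Submodule.span ℝ {ν})ᗮ) 1) := by
    rw [Measure.addHaar_ball_of_pos volume _ ht, hfin, ← Real.rpow_natCast, Nat.cast_sub hn,
      Nat.cast_one]
  have hH : Measure.euclideanHausdorffMeasure (n - 1) (G '' B)
      ≤ ((1 + K : ℝ≥0) : ℝ≥0∞) ^ ((n - 1 : ℕ) : ℝ) * volume B := by
    rw [← InnerProductSpace.euclideanHausdorffMeasure_eq_volume, hfin,
      Measure.euclideanHausdorffMeasure_def, Measure.euclideanHausdorffMeasure_def,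
      Measure.smul_apply, Measure.smul_apply, ENNReal.smul_def, ENNReal.smul_def, smul_eq_mul,
      smul_eq_mul, mul_left_comm]
    exact mul_le_mul_right (hG.hausdorffMeasure_image_le (by positivity) B) _
  refine hH.trans (le_of_eq ?_)
  rw [hvol]; ring

theorem ae_mem_frontier_surfaceMeasure (Ω : Set (EuclideanSpace ℝ (Fin n))) : ∀ᵐ Q ∂(surfaceMeasure Ω), Q ∈ frontier Ω :=
  ae_restrict_mem isClosed_frontier.measurableSet

/-- The boundary is covered by finitely many charts, so its surface measure is upper regular. -/
theorem upperRegular_surfaceMeasure {Ω : Set (EuclideanSpace ℝ (Fin n))} (hΩ : IsBoundedLipschitz Ω) (hn : 1 ≤ n) :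
    UpperRegular (surfaceMeasure Ω) ((n : ℝ) - 1) := by
  have hK : IsCompact (frontier Ω) :=
    isCompact_of_isClosed_isBounded isClosed_frontier
      (hΩ.isBounded.closure.subset frontier_subset_closure)
  choose! r C hr hC hb using fun P (hP : P ∈ frontier Ω) => exists_ball_surfaceMeasure_le hΩ hn hP
  obtain ⟨T, hT, hcov⟩ := hK.elim_nhds_subcover (fun P => ball P (r P))
    fun P hP => ball_mem_nhds P (hr P hP)
  refine ⟨∑ P ∈ T, C P, (ENNReal.sum_lt_top.2 fun P hP => (hC P (hT P hP)).lt_top).ne,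
    fun z t ht => ?_⟩
  have h1 : surfaceMeasure Ω (ball z t) ≤
      surfaceMeasure Ω (⋃ P ∈ T, ball P (r P) ∩ ball z t) := by
    refine measure_mono_ae ?_
    filter_upwards [ae_mem_frontier_surfaceMeasure Ω] with Q hQ hQz
    obtain ⟨P, hP, hQP⟩ := mem_iUnion₂.1 (hcov hQ)
    exact mem_iUnion₂.2 ⟨P, hP, hQP, hQz⟩
  refine h1.trans ((measure_biUnion_finset_le _ _).trans ?_)
  rw [Finset.sum_mul]
  exact Finset.sum_le_sum fun P hP => hb P (hT P hP) z t ht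

theorem isFiniteMeasure_surfaceMeasure {Ω : Set (EuclideanSpace ℝ (Fin n))} (hΩ : IsBoundedLipschitz Ω) (hn : 1 ≤ n) :
    IsFiniteMeasure (surfaceMeasure Ω) := by
  obtain ⟨C, hC, hb⟩ := upperRegular_surfaceMeasure hΩ hn
  obtain ⟨R, hR, hsub⟩ := hΩ.isBounded.closure.subset_ball_lt 0 0
  refine ⟨?_⟩
  have h1 : surfaceMeasure Ω univ ≤ surfaceMeasure Ω (ball 0 R) := by
    refine measure_mono_ae ?_
    filter_upwards [ae_mem_frontier_surfaceMeasure Ω] with Q hQ _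
    exact hsub (frontier_subset_closure hQ)
  exact h1.trans_lt ((hb 0 R hR).trans_lt (ENNReal.mul_lt_top hC.lt_top ENNReal.ofReal_lt_top))

/-- The boundary has finite `(n - 1)`-dimensional Hausdorff measure, so it is Lebesgue null. -/
theorem volume_frontier {Ω : Set (EuclideanSpace ℝ (Fin n))} (hΩ : IsBoundedLipschitz Ω) (hn : 1 ≤ n) :
    volume (frontier Ω) = 0 := by
  have := isFiniteMeasure_surfaceMeasure hΩ hn
  rw [← EuclideanSpace.euclideanHausdorffMeasure_eq_volume]
  refine (Measure.euclideanHausdorffMeasure_zero_or_top (show n - 1 < n by omega) _).resolve_right ?_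
  have := measure_ne_top (surfaceMeasure Ω) univ
  rwa [surfaceMeasure, Measure.restrict_apply_univ] at this

end Geometry

/-! ### Differences of a negative power of the norm -/

section Differences

theorem rpow_neg_sub_le {β p q : ℝ} (hβ : 0 < β) (hp : 0 < p) (hpq : p ≤ q) :
    p ^ (-β) - q ^ (-β) ≤ β * p ^ (-β) * ((q - p) / p) := by
  have hq : 0 < q := hp.trans_le hpq
  have h1 : 1 - β * ((q - p) / p) ≤ (q / p) ^ (-β) := by
    rw [Real.rpow_def_of_pos (by positivity)]
    have h2 := Real.add_one_le_exp (Real.log (q / p) * -β)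
    have h3 := Real.log_le_sub_one_of_pos (div_pos hq hp)
    have h4 : (q - p) / p = q / p - 1 := by field_simp
    rw [h4]
    nlinarith
  rw [Real.div_rpow hq.le hp.le, le_div_iff₀ (by positivity)] at h1
  linarith

variable {E : Type*} [NormedAddCommGroup E]

/-- The first difference of `|X| ^ (-β)`, over points at distance at least `m` from the origin. -/
theorem abs_rpow_norm_sub_le {β m : ℝ} (hβ : 0 < β) (hm : 0 < m) {X Y : E} (hX : m ≤ ‖X‖)
    (hY : m ≤ ‖Y‖) :
    |‖X‖ ^ (-β) - ‖Y‖ ^ (-β)| ≤ (1 + β) * m ^ (-β) * min 1 (‖X - Y‖ / m) := by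
  wlog hXY : ‖X‖ ≤ ‖Y‖ generalizing X Y
  · rw [abs_sub_comm, norm_sub_rev]
    exact this hY hX (le_of_not_ge hXY)
  have hX0 : 0 < ‖X‖ := hm.trans_le hX
  have hY0 : 0 < ‖Y‖ := hm.trans_le hY
  have hmono : ‖Y‖ ^ (-β) ≤ ‖X‖ ^ (-β) := Real.rpow_le_rpow_of_nonpos hX0 hXY (by linarith)
  have hXm : ‖X‖ ^ (-β) ≤ m ^ (-β) := Real.rpow_le_rpow_of_nonpos hm hX (by linarith)
  have hY1 : 0 < ‖Y‖ ^ (-β) := by positivity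
  have hm1 : 0 < m ^ (-β) := by positivity
  rw [abs_of_nonneg (by linarith), mul_min_of_nonneg _ _ (by positivity)]
  refine le_min ?_ ?_
  · nlinarith
  refine (rpow_neg_sub_le hβ hX0 hXY).trans ?_
  have h1 : (‖Y‖ - ‖X‖) / ‖X‖ ≤ ‖X - Y‖ / m := by
    refine div_le_div₀ (norm_nonneg _) ?_ hm hX
    rw [norm_sub_rev]; exact norm_sub_norm_le _ _
  refine mul_le_mul ?_ h1 (div_nonneg (by linarith) hX0.le) (by positivity)
  nlinarith

variable [InnerProductSpace ℝ E]

/-- The second mixed difference of `|X| ^ (-2 γ)`, over a parallelogram staying away from the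
origin, is controlled by the second derivative. -/
theorem abs_second_difference_le_of_small {γ m : ℝ} (hγ : 0 < γ) (hm : 0 < m) {X e h : E}
    (hX : m ≤ ‖X‖) (he : ‖e‖ ≤ m / 4) (hh : ‖h‖ ≤ m / 4) :
    |(‖X‖ ^ 2) ^ (-γ) - (‖X + h‖ ^ 2) ^ (-γ) - (‖X + e‖ ^ 2) ^ (-γ) + (‖X + e + h‖ ^ 2) ^ (-γ)|
      ≤ (4 * γ * (γ + 1) + 2 * γ) * ((m / 2) ^ 2) ^ (-γ - 1) * (‖e‖ * ‖h‖) := by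
  set Z : ℝ → ℝ → E := fun σ τ => X + σ • e + τ • h with hZ
  have hbig : ∀ σ ∈ Icc (0 : ℝ) 1, ∀ τ ∈ Icc (0 : ℝ) 1, m / 2 ≤ ‖Z σ τ‖ := by
    intro σ hσ τ hτ
    have h1 : ‖σ • e‖ ≤ m / 4 := by
      rw [norm_smul, Real.norm_of_nonneg hσ.1]
      nlinarith [norm_nonneg e, hσ.2]
    have h2 : ‖τ • h‖ ≤ m / 4 := by
      rw [norm_smul, Real.norm_of_nonneg hτ.1]
      nlinarith [norm_nonneg h, hτ.2]
    have h3 : ‖X‖ ≤ ‖Z σ τ‖ + ‖σ • e‖ + ‖τ • h‖ := by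
      have : X = Z σ τ - σ • e - τ • h := by simp only [hZ]; abel
      calc ‖X‖ = ‖Z σ τ - σ • e - τ • h‖ := by rw [← this]
        _ ≤ _ := (norm_sub_le _ _).trans (by gcongr; exact norm_sub_le _ _)
    linarith
  have hpos : ∀ σ ∈ Icc (0 : ℝ) 1, ∀ τ ∈ Icc (0 : ℝ) 1, ‖Z σ τ‖ ^ 2 ≠ 0 := fun σ hσ τ hτ =>
    (pow_pos ((half_pos hm).trans_le (hbig σ hσ τ hτ)) 2).ne'
  have h0 : (0 : ℝ) ∈ Icc (0 : ℝ) 1 := by simp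
  have h1 : (1 : ℝ) ∈ Icc (0 : ℝ) 1 := by simp
  have dσ : ∀ σ τ, HasDerivAt (fun σ => Z σ τ) e σ := fun σ τ => by
    have := ((hasDerivAt_id σ).smul_const e |>.const_add X).add_const (τ • h)
    rwa [one_smul] at this
  have dτ : ∀ σ τ, HasDerivAt (fun τ => Z σ τ) h τ := fun σ τ => by
    have := ((hasDerivAt_id τ).smul_const h).const_add (X + σ • e)
    rwa [one_smul] at this
  have dG : ∀ σ ∈ Icc (0 : ℝ) 1, ∀ τ ∈ Icc (0 : ℝ) 1, HasDerivAt (fun σ => (‖Z σ τ‖ ^ 2) ^ (-γ))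
      (2 * inner ℝ (Z σ τ) e * (-γ) * (‖Z σ τ‖ ^ 2) ^ (-γ - 1)) σ := fun σ hσ τ hτ =>
    (dσ σ τ).norm_sq.rpow_const (Or.inl (hpos σ hσ τ hτ))
  obtain ⟨σ, hσ, hσe⟩ := exists_hasDerivAt_eq_slope
    (fun σ => (‖Z σ 1‖ ^ 2) ^ (-γ) - (‖Z σ 0‖ ^ 2) ^ (-γ)) _ zero_lt_one
    (fun σ hσ => ((dG σ hσ 1 h1).sub (dG σ hσ 0 h0)).continuousAt.continuousWithinAt)
    (fun σ hσ => (dG σ ⟨hσ.1.le, hσ.2.le⟩ 1 h1).sub (dG σ ⟨hσ.1.le, hσ.2.le⟩ 0 h0))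
  have hσ' : σ ∈ Icc (0 : ℝ) 1 := ⟨hσ.1.le, hσ.2.le⟩
  have dH : ∀ τ ∈ Icc (0 : ℝ) 1, HasDerivAt
      (fun τ => 2 * inner ℝ (Z σ τ) e * (-γ) * (‖Z σ τ‖ ^ 2) ^ (-γ - 1))
      (2 * inner ℝ h e * (-γ) * (‖Z σ τ‖ ^ 2) ^ (-γ - 1) + 2 * inner ℝ (Z σ τ) e * (-γ) *
        (2 * inner ℝ (Z σ τ) h * (-γ - 1) * (‖Z σ τ‖ ^ 2) ^ (-γ - 1 - 1))) τ := fun τ hτ => by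
    have a1 : HasDerivAt (fun τ => inner ℝ (Z σ τ) e) (inner ℝ h e) τ := by
      simpa using (dτ σ τ).inner ℝ (hasDerivAt_const τ e)
    exact ((a1.const_mul 2).mul_const (-γ)).mul
      ((dτ σ τ).norm_sq.rpow_const (Or.inl (hpos σ hσ' τ hτ)))
  obtain ⟨τ, hτ, hτe⟩ := exists_hasDerivAt_eq_slope _ _ zero_lt_one
    (fun τ hτ => (dH τ hτ).continuousAt.continuousWithinAt)
    (fun τ hτ => dH τ ⟨hτ.1.le, hτ.2.le⟩)
  have hτ' : τ ∈ Icc (0 : ℝ) 1 := ⟨hτ.1.le, hτ.2.le⟩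
  simp only [sub_zero, div_one] at hσe hτe
  have e1 : (‖X‖ ^ 2) ^ (-γ) - (‖X + h‖ ^ 2) ^ (-γ) - (‖X + e‖ ^ 2) ^ (-γ)
      + (‖X + e + h‖ ^ 2) ^ (-γ) = (‖Z 1 1‖ ^ 2) ^ (-γ) - (‖Z 1 0‖ ^ 2) ^ (-γ)
        - ((‖Z 0 1‖ ^ 2) ^ (-γ) - (‖Z 0 0‖ ^ 2) ^ (-γ)) := by
    simp only [hZ, one_smul, zero_smul, add_zero]; ring
  rw [e1, ← hσe, ← hτe]
  set N := ‖Z σ τ‖ with hN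
  have hN2 : m / 2 ≤ N := hbig σ hσ' τ hτ'
  have hN0 : 0 < N := (half_pos hm).trans_le hN2
  have hpw : (N ^ 2) ^ (-γ - 1) ≤ ((m / 2) ^ 2) ^ (-γ - 1) :=
    Real.rpow_le_rpow_of_nonpos (by positivity) (by gcongr) (by linarith)
  have hpw2 : (N ^ 2) ^ (-γ - 1 - 1) * N ^ 2 = (N ^ 2) ^ (-γ - 1) := by
    rw [Real.rpow_sub_one (by positivity)]
    field_simp
  have i1 : |inner ℝ h e| ≤ ‖e‖ * ‖h‖ := by rw [mul_comm]; exact abs_real_inner_le_norm h e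
  have i2 : |inner ℝ (Z σ τ) e| ≤ N * ‖e‖ := abs_real_inner_le_norm _ _
  have i3 : |inner ℝ (Z σ τ) h| ≤ N * ‖h‖ := abs_real_inner_le_norm _ _
  have hP : 0 ≤ (N ^ 2) ^ (-γ - 1) := by positivity
  have hP2 : 0 ≤ (N ^ 2) ^ (-γ - 1 - 1) := by positivity
  calc _ ≤ |2 * inner ℝ h e * (-γ) * (N ^ 2) ^ (-γ - 1)| + |2 * inner ℝ (Z σ τ) e * (-γ) *
        (2 * inner ℝ (Z σ τ) h * (-γ - 1) * (N ^ 2) ^ (-γ - 1 - 1))| := abs_add_le _ _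
    _ = 2 * γ * (N ^ 2) ^ (-γ - 1) * |inner ℝ h e| + 4 * γ * (γ + 1) *
        (N ^ 2) ^ (-γ - 1 - 1) * (|inner ℝ (Z σ τ) e| * |inner ℝ (Z σ τ) h|) := by
      simp only [abs_mul, abs_neg, abs_of_pos hγ, abs_of_nonneg hP, abs_of_nonneg hP2,
        abs_two]
      rw [abs_of_neg (by linarith : -γ - 1 < 0)]
      ring
    _ ≤ 2 * γ * (N ^ 2) ^ (-γ - 1) * (‖e‖ * ‖h‖) + 4 * γ * (γ + 1) *
        (N ^ 2) ^ (-γ - 1 - 1) * ((N * ‖e‖) * (N * ‖h‖)) := by gcongr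
    _ = (4 * γ * (γ + 1) + 2 * γ) * (N ^ 2) ^ (-γ - 1) * (‖e‖ * ‖h‖) := by
      rw [← hpw2]; ring
    _ ≤ _ := by gcongr

/-- The second mixed difference of `|X| ^ (-β)` over a parallelogram with vertices at distance at
least `m` from the origin; its interior may come close to the origin. -/
theorem exists_abs_second_difference_le {β : ℝ} (hβ : 0 < β) :
    ∃ C : ℝ, 0 < C ∧ ∀ (m : ℝ) (X e h : E), 0 < m → m ≤ ‖X‖ → m ≤ ‖X + h‖ → m ≤ ‖X + e‖ →
      m ≤ ‖X + e + h‖ →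
      |‖X‖ ^ (-β) - ‖X + h‖ ^ (-β) - ‖X + e‖ ^ (-β) + ‖X + e + h‖ ^ (-β)|
        ≤ C * m ^ (-β) * min 1 (‖e‖ / m) * min 1 (‖h‖ / m) := by
  set C₂ : ℝ := (4 * (β / 2) * (β / 2 + 1) + 2 * (β / 2)) * (2⁻¹ ^ (2 : ℕ)) ^ (-(β / 2) - 1)
  have hC₂ : 0 < C₂ := by positivity
  refine ⟨8 * (1 + β) + C₂, by positivity, fun m X e h hm h00 h01 h10 h11 => ?_⟩
  have hm1 : 0 < m ^ (-β) := by positivity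
  have he0 : 0 ≤ min 1 (‖e‖ / m) := by positivity
  have hh0 : 0 ≤ min 1 (‖h‖ / m) := by positivity
  by_cases he : ‖e‖ ≤ m / 4
  · by_cases hh : ‖h‖ ≤ m / 4
    · have key := abs_second_difference_le_of_small (half_pos hβ) hm h00 he hh
      have sq : ∀ Y : E, (‖Y‖ ^ 2) ^ (-(β / 2)) = ‖Y‖ ^ (-β) := fun Y => by
        rw [← Real.rpow_natCast, ← Real.rpow_mul (norm_nonneg _)]
        congr 1; push_cast; ring
      simp only [sq] at key
      rw [min_eq_right ((div_le_one hm).2 (by linarith)),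
        min_eq_right ((div_le_one hm).2 (by linarith))]
      have e1 : ((m / 2) ^ 2) ^ (-(β / 2) - 1)
          = (2⁻¹ ^ (2 : ℕ)) ^ (-(β / 2) - 1) * m ^ (-β) / m ^ 2 := by
        rw [div_eq_inv_mul, mul_pow, Real.mul_rpow (by positivity) (by positivity),
          Real.rpow_sub_one (x := m ^ 2) (by positivity), ← Real.rpow_natCast m,
          ← Real.rpow_mul hm.le, mul_div_assoc]
        congr 3; push_cast; ring
      rw [e1] at key
      refine key.trans ?_
      have : (4 * (β / 2) * (β / 2 + 1) + 2 * (β / 2)) *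
          ((2⁻¹ ^ (2 : ℕ)) ^ (-(β / 2) - 1) * m ^ (-β) / m ^ 2) * (‖e‖ * ‖h‖)
          = C₂ * m ^ (-β) * (‖e‖ / m) * (‖h‖ / m) := by
        simp only [C₂]
        ring
      rw [this]
      gcongr
      linarith
    · have hmin : 1 ≤ 4 * min 1 (‖h‖ / m) := by
        rw [mul_min_of_nonneg _ _ (by norm_num)]
        refine le_min (by norm_num) ?_
        rw [← mul_div_assoc, le_div_iff₀ hm]; linarith
      have k1 := abs_rpow_norm_sub_le hβ hm h00 h10
      have k2 := abs_rpow_norm_sub_le hβ hm h01 h11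
      rw [show X - (X + e) = -e by abel, norm_neg] at k1
      rw [show X + h - (X + e + h) = -e by abel, norm_neg] at k2
      have : ‖X‖ ^ (-β) - ‖X + h‖ ^ (-β) - ‖X + e‖ ^ (-β) + ‖X + e + h‖ ^ (-β)
          = (‖X‖ ^ (-β) - ‖X + e‖ ^ (-β)) - (‖X + h‖ ^ (-β) - ‖X + e + h‖ ^ (-β)) := by ring
      rw [this]
      calc _ ≤ _ := abs_sub _ _
        _ ≤ 2 * (1 + β) * m ^ (-β) * min 1 (‖e‖ / m) * 1 := by linarith
        _ ≤ 2 * (1 + β) * m ^ (-β) * min 1 (‖e‖ / m) * (4 * min 1 (‖h‖ / m)) := by gcongr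
        _ = (8 * (1 + β)) * m ^ (-β) * min 1 (‖e‖ / m) * min 1 (‖h‖ / m) := by ring
        _ ≤ _ := by gcongr; linarith
  · have hmin : 1 ≤ 4 * min 1 (‖e‖ / m) := by
      rw [mul_min_of_nonneg _ _ (by norm_num)]
      refine le_min (by norm_num) ?_
      rw [← mul_div_assoc, le_div_iff₀ hm]; linarith
    have k1 := abs_rpow_norm_sub_le hβ hm h00 h01
    have k2 := abs_rpow_norm_sub_le hβ hm h10 h11
    rw [show X - (X + h) = -h by abel, norm_neg] at k1
    rw [show X + e - (X + e + h) = -h by abel, norm_neg] at k2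
    have : ‖X‖ ^ (-β) - ‖X + h‖ ^ (-β) - ‖X + e‖ ^ (-β) + ‖X + e + h‖ ^ (-β)
        = (‖X‖ ^ (-β) - ‖X + h‖ ^ (-β)) - (‖X + e‖ ^ (-β) - ‖X + e + h‖ ^ (-β)) := by ring
    rw [this]
    calc _ ≤ _ := abs_sub _ _
      _ ≤ 2 * (1 + β) * m ^ (-β) * 1 * min 1 (‖h‖ / m) := by linarith
      _ ≤ 2 * (1 + β) * m ^ (-β) * (4 * min 1 (‖e‖ / m)) * min 1 (‖h‖ / m) := by gcongr
      _ = (8 * (1 + β)) * m ^ (-β) * min 1 (‖e‖ / m) * min 1 (‖h‖ / m) := by ring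
      _ ≤ _ := by gcongr; linarith

/-- The square of a damped difference quotient is a critical radial kernel times a power of the
distance `ρ` to the singularity. -/
theorem sq_min_div_rpow {d σ τ ρ : ℝ} (hτ : 0 < τ) (hρ : 0 < ρ) :
    (min 1 (τ / ρ) / τ ^ ((d + 2 * σ) / 2)) ^ 2
      = ρ ^ (-(2 * σ)) * radialKernel d (2 - 2 * σ) (2 * σ) τ ρ := by
  have e1 : (τ ^ ((d + 2 * σ) / 2)) ^ 2 = τ ^ d * τ ^ (2 * σ) := by
    rw [← Real.rpow_natCast, ← Real.rpow_mul hτ.le, ← Real.rpow_add hτ]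
    congr 1; push_cast; ring
  have hr := div_pos hτ hρ
  have e2 : (ρ / τ) ^ (2 * σ) = (τ / ρ) ^ (-(2 * σ)) := by
    rw [Real.rpow_neg hr.le, ← Real.inv_rpow hr.le, inv_div]
  rw [div_pow, e1, radialKernel, e2]
  have e3 : min ((τ / ρ) ^ (2 - 2 * σ)) ((τ / ρ) ^ (-(2 * σ)))
      = min 1 (τ / ρ) ^ 2 * (τ / ρ) ^ (-(2 * σ)) := by
    rcases le_total (τ / ρ) 1 with h | h
    · rw [min_eq_right h, min_eq_left (Real.rpow_le_rpow_of_exponent_ge hr h (by linarith)),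
        ← Real.rpow_natCast, ← Real.rpow_add hr]
      congr 1
    · rw [min_eq_left h, min_eq_right (Real.rpow_le_rpow_of_exponent_le h (by linarith))]
      ring
  rw [e3, Real.div_rpow hτ.le hρ.le, Real.rpow_neg hτ.le, Real.rpow_neg hτ.le, Real.rpow_neg hρ.le]
  have := (Real.rpow_pos_of_pos hτ d).ne'
  have := (Real.rpow_pos_of_pos hτ (2 * σ)).ne'
  have := (Real.rpow_pos_of_pos hρ (2 * σ)).ne'
  field_simp

/-- The damping factor of a radial kernel is shared between two radial kernels, one in the
variable `τ` and one in the scale `ρ`. -/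
theorem radialKernel_eq_mul {d d' p q τ ρ : ℝ} (hτ : 0 < τ) (hρ : 0 < ρ) :
    radialKernel d (2 * p) (2 * q) τ ρ
      = ρ ^ d' * radialKernel d' q p ρ τ * radialKernel d p q τ ρ := by
  have h2 : ∀ {a : ℝ} (c : ℝ), 0 < a → a ^ (2 * c) = a ^ c * a ^ c := fun c ha => by
    rw [two_mul, Real.rpow_add ha]
  have hA : 0 < (τ / ρ) ^ p := by positivity
  have hB : 0 < (ρ / τ) ^ q := by positivity
  have e1 : min ((τ / ρ) ^ (2 * p)) ((ρ / τ) ^ (2 * q))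
      = min ((τ / ρ) ^ p) ((ρ / τ) ^ q) * min ((τ / ρ) ^ p) ((ρ / τ) ^ q) := by
    rw [h2 p (by positivity), h2 q (by positivity)]
    rcases le_total ((τ / ρ) ^ p) ((ρ / τ) ^ q) with h | h
    · rw [min_eq_left h, min_eq_left (mul_le_mul h h hA.le hB.le)]
    · rw [min_eq_right h, min_eq_right (mul_le_mul h h hB.le hA.le)]
  unfold radialKernel
  rw [e1, min_comm ((ρ / τ) ^ q), Real.rpow_neg hρ.le]
  have := (Real.rpow_pos_of_pos hρ d').ne'
  field_simp

end Differences

/-! ### Schur's test -/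

section Schur

variable {X Y : Type*} [MeasurableSpace X] [MeasurableSpace Y]
variable {𝕜 : Type*} [RCLike 𝕜]

/-- The kernel `k` defines, together with its absolute value, a bounded integral operator from
`L²(τ)` to `L²(σ)`. -/
def BoundedKernel (σ : Measure X) (τ : Measure Y) (k : X → Y → 𝕜) : Prop :=
  ∃ C : ℝ≥0∞, C ≠ ⊤ ∧ ∀ f : Y → ℝ≥0∞, Measurable f →
    ∫⁻ x, (∫⁻ y, ‖k x y‖ₑ * f y ∂τ) ^ 2 ∂σ ≤ C * ∫⁻ y, f y ^ 2 ∂τ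

/-- The Cauchy-Schwarz inequality for lower integrals. -/
theorem lintegral_mul_sq_le {τ : Measure Y} {f g : Y → ℝ≥0∞} (hf : AEMeasurable f τ)
    (hg : AEMeasurable g τ) :
    (∫⁻ y, f y * g y ∂τ) ^ 2 ≤ (∫⁻ y, f y ^ 2 ∂τ) * ∫⁻ y, g y ^ 2 ∂τ := by
  have h := ENNReal.lintegral_mul_le_Lp_mul_Lq τ Real.HolderConjugate.two_two hf hg
  have h2 : ∀ a : ℝ≥0∞, (a ^ (1 / 2 : ℝ)) ^ 2 = a := fun a => by
    rw [← ENNReal.rpow_natCast, ← ENNReal.rpow_mul]; norm_num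
  calc _ ≤ _ := pow_le_pow_left' h 2
    _ = _ := by simp only [mul_pow, h2, ENNReal.rpow_two]

/-- Schur's test, in the form adapted to weights: a kernel whose square is at most the product of
two kernels, one uniformly integrable in each variable, is bounded on `L²`. -/
theorem boundedKernel_of_sq_le {σ : Measure X} {τ : Measure Y} [SFinite σ] [SFinite τ]
    {k : X → Y → 𝕜} {K₁ K₂ : X → Y → ℝ≥0∞} (hK₁ : Measurable (Function.uncurry K₁))
    (hK₂ : Measurable (Function.uncurry K₂))
    (hk : ∀ᵐ x ∂σ, ∀ᵐ y ∂τ, ‖k x y‖ₑ ^ 2 ≤ K₁ x y * K₂ x y)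
    {C₁ C₂ : ℝ≥0∞} (hC₁ : C₁ ≠ ⊤) (hC₂ : C₂ ≠ ⊤)
    (h₁ : ∀ᵐ y ∂τ, ∫⁻ x, K₁ x y ∂σ ≤ C₁) (h₂ : ∀ᵐ x ∂σ, ∫⁻ y, K₂ x y ∂τ ≤ C₂) :
    BoundedKernel σ τ k := by
  refine ⟨C₂ * C₁, ENNReal.mul_ne_top hC₂ hC₁, fun f hf => ?_⟩
  have hs : ∀ a : ℝ≥0∞, (a ^ (1 / 2 : ℝ)) ^ 2 = a := fun a => by
    rw [← ENNReal.rpow_natCast, ← ENNReal.rpow_mul]; norm_num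
  have hpt : ∀ᵐ x ∂σ, (∫⁻ y, ‖k x y‖ₑ * f y ∂τ) ^ 2 ≤ C₂ * ∫⁻ y, K₁ x y * f y ^ 2 ∂τ := by
    filter_upwards [hk, h₂] with x hkx h₂x
    have m1 : Measurable fun y => K₁ x y := hK₁.comp measurable_prodMk_left
    have m2 : Measurable fun y => K₂ x y := hK₂.comp measurable_prodMk_left
    have h3 : ∫⁻ y, ‖k x y‖ₑ * f y ∂τ ≤
        ∫⁻ y, (K₁ x y ^ (1 / 2 : ℝ) * f y) * K₂ x y ^ (1 / 2 : ℝ) ∂τ := by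
      refine lintegral_mono_ae ?_
      filter_upwards [hkx] with y hy
      have h4 : ‖k x y‖ₑ ≤ K₁ x y ^ (1 / 2 : ℝ) * K₂ x y ^ (1 / 2 : ℝ) := by
        rw [← ENNReal.mul_rpow_of_nonneg _ _ (by norm_num)]
        refine le_trans (le_of_eq ?_) (ENNReal.rpow_le_rpow hy (by norm_num))
        rw [← ENNReal.rpow_natCast, ← ENNReal.rpow_mul]; norm_num
      calc _ ≤ _ := mul_le_mul_left h4 _
        _ = _ := by ring
    calc _ ≤ _ := pow_le_pow_left' h3 2
      _ ≤ _ := lintegral_mul_sq_le ((m1.pow_const _).mul hf).aemeasurable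
        (m2.pow_const _).aemeasurable
      _ = (∫⁻ y, K₁ x y * f y ^ 2 ∂τ) * ∫⁻ y, K₂ x y ∂τ := by simp only [mul_pow, hs]
      _ ≤ _ := by rw [mul_comm]; exact mul_le_mul_left h₂x _
  have hm : Measurable (Function.uncurry fun x y => K₁ x y * f y ^ 2) :=
    hK₁.mul ((hf.comp measurable_snd).pow_const 2)
  calc _ ≤ ∫⁻ x, C₂ * ∫⁻ y, K₁ x y * f y ^ 2 ∂τ ∂σ := lintegral_mono_ae hpt
    _ = C₂ * ∫⁻ y, ∫⁻ x, K₁ x y * f y ^ 2 ∂σ ∂τ := by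
      rw [lintegral_const_mul' _ _ hC₂, lintegral_lintegral_swap hm.aemeasurable]
    _ ≤ C₂ * ∫⁻ y, C₁ * f y ^ 2 ∂τ := by
      refine mul_le_mul_right (lintegral_mono_ae ?_) _
      filter_upwards [h₁] with y hy
      have m1 : Measurable fun x => K₁ x y := hK₁.comp measurable_prodMk_right
      rw [lintegral_mul_const _ m1]
      exact mul_le_mul_left hy _
    _ = _ := by rw [lintegral_const_mul' _ _ hC₁, mul_assoc]

theorem add_sq_le_four_mul (a b : ℝ≥0∞) : (a + b) ^ 2 ≤ 4 * (a ^ 2 + b ^ 2) := by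
  wlog h : a ≤ b generalizing a b
  · rw [add_comm, add_comm (a ^ 2)]; exact this b a (le_of_not_ge h)
  calc (a + b) ^ 2 ≤ (b + b) ^ 2 := by gcongr
    _ = 4 * b ^ 2 := by ring
    _ ≤ _ := by gcongr; exact le_add_self

theorem eLpNorm_two_sq {μ : Measure X} (f : X → 𝕜) :
    eLpNorm f 2 μ ^ 2 = ∫⁻ x, ‖f x‖ₑ ^ 2 ∂μ := by
  have := eLpNorm_nnreal_pow_eq_lintegral (f := f) (μ := μ) (p := 2) (by norm_num)
  simpa using this

theorem memLp_two_of_lintegral_lt_top {μ : Measure X} {f : X → 𝕜} (hf : AEStronglyMeasurable f μ)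
    (h : ∫⁻ x, ‖f x‖ₑ ^ 2 ∂μ < ⊤) : MemLp f 2 μ := by
  refine ⟨hf, ?_⟩
  rw [← eLpNorm_two_sq] at h
  exact lt_top_iff_ne_top.2 fun h0 => by simp [h0] at h

theorem ofReal_norm_toLp_sq {μ : Measure X} {f : X → 𝕜} (hf : MemLp f 2 μ) :
    ENNReal.ofReal (‖hf.toLp f‖ ^ 2) = ∫⁻ x, ‖f x‖ₑ ^ 2 ∂μ := by
  rw [Lp.norm_toLp, ENNReal.ofReal_pow ENNReal.toReal_nonneg, ENNReal.ofReal_toReal hf.2.ne,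
    eLpNorm_two_sq]

/-- The absolute integrability that justifies exchanging the integrations in `∫ F (∫ k f)`, for a
bounded kernel `k`, over a space of finite measure. -/
theorem BoundedKernel.integrable {σ : Measure X} {τ : Measure Y} [IsFiniteMeasure σ] [SFinite τ]
    {k : X → Y → 𝕜} (hk : BoundedKernel σ τ k) (hkm : StronglyMeasurable (Function.uncurry k))
    {F : X → 𝕜} (hF : StronglyMeasurable F) {M : ℝ} (hM : ∀ x, ‖F x‖ ≤ M) {f : Y → 𝕜}
    (hf : StronglyMeasurable f) (hf2 : ∫⁻ y, ‖f y‖ₑ ^ 2 ∂τ ≠ ⊤) :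
    Integrable (fun p : X × Y => F p.1 * (f p.2 * k p.1 p.2)) (σ.prod τ) := by
  have hm : StronglyMeasurable fun p : X × Y => F p.1 * (f p.2 * k p.1 p.2) :=
    (hF.comp_measurable measurable_fst).mul ((hf.comp_measurable measurable_snd).mul hkm)
  refine ⟨hm.aestronglyMeasurable, ?_⟩
  obtain ⟨C, hC, hb⟩ := hk
  have hfin := (hb _ hf.enorm).trans_lt (ENNReal.mul_lt_top hC.lt_top hf2.lt_top)
  rw [HasFiniteIntegral, lintegral_prod _ hm.enorm.aemeasurable]
  have hle : ∀ x, ∫⁻ y, ‖F x * (f y * k x y)‖ₑ ∂τ ≤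
      ENNReal.ofReal M * (1 + (∫⁻ y, ‖k x y‖ₑ * ‖f y‖ₑ ∂τ) ^ 2) := by
    intro x
    have e : ∀ a : ℝ≥0∞, a ≤ 1 + a ^ 2 := fun a => by
      rcases le_total a 1 with h | h
      · exact h.trans le_self_add
      · refine le_trans ?_ le_add_self
        calc a = a ^ 1 := (pow_one a).symm
          _ ≤ a ^ 2 := pow_le_pow_right₀ h (by norm_num)
    have hFx : ‖F x‖ₑ ≤ ENNReal.ofReal M := by
      rw [← ofReal_norm]; exact ENNReal.ofReal_le_ofReal (hM x)
    simp only [enorm_mul]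
    rw [lintegral_const_mul' _ _ enorm_ne_top]
    refine mul_le_mul' hFx (le_trans (le_of_eq ?_) (e _))
    simp only [mul_comm]
  refine (lintegral_mono hle).trans_lt ?_
  rw [lintegral_const_mul' _ _ ENNReal.ofReal_ne_top, lintegral_add_left measurable_const]
  refine ENNReal.mul_lt_top ENNReal.ofReal_lt_top (ENNReal.add_lt_top.2 ⟨?_, hfin⟩)
  simp [measure_lt_top]

end Schur

/-! ### Duality for fractional Sobolev spaces -/

section Duality

variable {E : Type*} [NormedAddCommGroup E] [MeasurableSpace E]
variable {𝕜 : Type*} [RCLike 𝕜]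

/-- Continuous functionals on `H^α(μ)` are integrals against `L²` densities: extend to
`L²(μ) × L²(μ × μ)` by Hahn-Banach and apply the Riesz representation theorem there. -/
theorem exists_dual_rep {μ : Measure E} {d α : ℝ} (φ : FracSobolev 𝕜 μ d α →L[𝕜] 𝕜) :
    ∃ (w : E → 𝕜) (W : E × E → 𝕜), StronglyMeasurable w ∧ StronglyMeasurable W ∧
      MemLp w 2 μ ∧ MemLp W 2 (μ.prod μ) ∧
      ∫⁻ x, ‖w x‖ₑ ^ 2 ∂μ ≤ ENNReal.ofReal (‖φ‖ ^ 2) ∧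
      ∫⁻ p, ‖W p‖ₑ ^ 2 ∂(μ.prod μ) ≤ ENNReal.ofReal (‖φ‖ ^ 2) ∧
      ∀ (g : E → 𝕜) (h : MemFracSobolev μ d α g),
        φ h.toSobolev = ∫ x, w x * g x ∂μ + ∫ p, W p * diffQuot d α g p ∂(μ.prod μ) := by
  obtain ⟨Φ, hΦ, hn⟩ := exists_extension_norm_eq (FracSobolev 𝕜 μ d α) φ
  set v := (InnerProductSpace.toDual 𝕜 (WithLp 2 (Lp 𝕜 2 μ × Lp 𝕜 2 (μ.prod μ)))).symm Φ with hv
  have hvn : ‖v‖ = ‖φ‖ := by rw [hv, LinearIsometryEquiv.norm_map, hn]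
  have hsq : ‖v.fst‖ ^ 2 + ‖v.snd‖ ^ 2 = ‖φ‖ ^ 2 := by
    rw [← hvn]; exact (WithLp.prod_norm_sq_eq_of_L2 v).symm
  have nrm : ∀ {Z : Type _} [MeasurableSpace Z] {τ : Measure Z} (g : Lp 𝕜 2 τ),
      ∫⁻ z, ‖star (g z)‖ₑ ^ 2 ∂τ = ENNReal.ofReal (‖g‖ ^ 2) := fun g => by
    have h := ofReal_norm_toLp_sq (Lp.memLp g)
    rw [Lp.toLp_coeFn] at h
    rw [h]
    congr 1 with z
    rw [← ofReal_norm, norm_star, ofReal_norm]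
  refine ⟨fun x => star (v.fst x), fun p => star (v.snd p), ?_, ?_, ?_, ?_, ?_, ?_, ?_⟩
  · exact continuous_star.comp_stronglyMeasurable (Lp.stronglyMeasurable _)
  · exact continuous_star.comp_stronglyMeasurable (Lp.stronglyMeasurable _)
  · exact (Lp.memLp v.fst).star
  · exact (Lp.memLp v.snd).star
  · rw [nrm]; exact ENNReal.ofReal_le_ofReal (by linarith [sq_nonneg ‖v.snd‖])
  · rw [nrm]; exact ENNReal.ofReal_le_ofReal (by linarith [sq_nonneg ‖v.fst‖])
  · intro g h
    have h1 : φ h.toSobolev = inner 𝕜 v (h.toSobolev : WithLp 2 (Lp 𝕜 2 μ × Lp 𝕜 2 (μ.prod μ))) := by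
      rw [hv, InnerProductSpace.toDual_symm_apply, hΦ]
    rw [h1, WithLp.prod_inner_apply, L2.inner_def, L2.inner_def]
    congr 1
    · refine integral_congr_ae ?_
      filter_upwards [h.1.coeFn_toLp] with x hx
      rw [RCLike.inner_apply, mul_comm]
      congr 1
    · refine integral_congr_ae ?_
      filter_upwards [h.2.coeFn_toLp] with x hx
      rw [RCLike.inner_apply, mul_comm]
      congr 1

variable [BorelSpace E] [SecondCountableTopology E]

theorem stronglyMeasurable_diffQuot_uncurry {X : Type*} [MeasurableSpace X] (d α : ℝ)
    {Γ : X → E → 𝕜} (hΓ : StronglyMeasurable (Function.uncurry Γ)) :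
    StronglyMeasurable (Function.uncurry fun x p => diffQuot d α (Γ x) p) := by
  refine StronglyMeasurable.smul (f := fun q : X × E × E => (‖q.2.1 - q.2.2‖ ^ ((d + 2 * α) / 2))⁻¹)
    ?_ ((hΓ.comp_measurable (g := fun q : X × E × E => (q.1, q.2.1)) (by fun_prop)).sub
      (hΓ.comp_measurable (g := fun q : X × E × E => (q.1, q.2.2)) (by fun_prop)))
  exact Measurable.stronglyMeasurable (by fun_prop)

theorem aestronglyMeasurable_diffQuot {ν : Measure E} [SFinite ν] (d α : ℝ) {f : E → 𝕜}
    (hf : AEStronglyMeasurable f ν) : AEStronglyMeasurable (diffQuot d α f) (ν.prod ν) := by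
  refine AEStronglyMeasurable.smul (f := fun q : E × E => (‖q.1 - q.2‖ ^ ((d + 2 * α) / 2))⁻¹)
    ?_ (hf.comp_fst.sub hf.comp_snd)
  exact (Measurable.stronglyMeasurable (by fun_prop)).aestronglyMeasurable

variable {μ ν : Measure E} [SFinite μ] {d α d' s : ℝ} {Γ : E → E → 𝕜}

/-- The potential of `φ` with kernel `Γ` maps into `H^s(ν)` as soon as `Γ` and its difference
quotients in either or both variables are bounded kernels. -/
theorem exists_norm_toSobolev_le [SFinite ν] (hΓ : StronglyMeasurable (Function.uncurry Γ))
    (h00 : BoundedKernel ν μ Γ)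
    (h10 : BoundedKernel ν (μ.prod μ) fun x p => diffQuot d α (Γ x) p)
    (h01 : BoundedKernel (ν.prod ν) μ fun p Q => diffQuot d' s (fun x => Γ x Q) p)
    (h11 : BoundedKernel (ν.prod ν) (μ.prod μ) fun p q =>
      diffQuot d' s (fun x => diffQuot d α (Γ x) q) p) :
    ∃ c : ℝ, 0 < c ∧ ∀ (φ : FracSobolev 𝕜 μ d α →L[𝕜] 𝕜) (u : E → 𝕜),
      (∀ᵐ x ∂ν, ∃ h : MemFracSobolev μ d α (Γ x), u x = φ h.toSobolev) →
      ∃ h : MemFracSobolev ν d' s u, ‖h.toSobolev‖ ≤ c * ‖φ‖ := by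
  obtain ⟨C00, hC00, b00⟩ := h00
  obtain ⟨C10, hC10, b10⟩ := h10
  obtain ⟨C01, hC01, b01⟩ := h01
  obtain ⟨C11, hC11, b11⟩ := h11
  set A := 4 * (C00 + C10) with hA
  set B := 4 * (C01 + C11) with hB
  have hA' : A ≠ ⊤ := ENNReal.mul_ne_top (by norm_num) (ENNReal.add_ne_top.2 ⟨hC00, hC10⟩)
  have hB' : B ≠ ⊤ := ENNReal.mul_ne_top (by norm_num) (ENNReal.add_ne_top.2 ⟨hC01, hC11⟩)
  refine ⟨1 + A.toReal + B.toReal, by positivity, fun φ u hu => ?_⟩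
  obtain ⟨w, W, hw, hW, hw2, hW2, hwn, hWn, hrep⟩ := exists_dual_rep φ
  -- both integrals of a pair of kernels against `w` and `W` are controlled in the same way
  have bound : ∀ {Z : Type _} [MeasurableSpace Z] (ζ : Measure Z) (k : Z → E → 𝕜)
      (l : Z → E × E → 𝕜) (U : Z → 𝕜) (C D : ℝ≥0∞),
      (∀ f : E → ℝ≥0∞, Measurable f →
        ∫⁻ x, (∫⁻ y, ‖k x y‖ₑ * f y ∂μ) ^ 2 ∂ζ ≤ C * ∫⁻ y, f y ^ 2 ∂μ) →
      (∀ f : E × E → ℝ≥0∞, Measurable f →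
        ∫⁻ x, (∫⁻ y, ‖l x y‖ₑ * f y ∂(μ.prod μ)) ^ 2 ∂ζ ≤ D * ∫⁻ y, f y ^ 2 ∂(μ.prod μ)) →
      Measurable (fun z => ∫⁻ y, ‖k z y‖ₑ * ‖w y‖ₑ ∂μ) →
      (∀ᵐ z ∂ζ, U z = ∫ y, w y * k z y ∂μ + ∫ q, W q * l z q ∂(μ.prod μ)) →
      ∫⁻ z, ‖U z‖ₑ ^ 2 ∂ζ ≤ 4 * (C + D) * ENNReal.ofReal (‖φ‖ ^ 2) := by
    intro Z _ ζ k l U C D hk hl hm hU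
    have hpt : ∀ᵐ z ∂ζ, ‖U z‖ₑ ^ 2 ≤ 4 * ((∫⁻ y, ‖k z y‖ₑ * ‖w y‖ₑ ∂μ) ^ 2
        + (∫⁻ y, ‖l z y‖ₑ * ‖W y‖ₑ ∂(μ.prod μ)) ^ 2) := by
      filter_upwards [hU] with z hz
      refine le_trans (pow_le_pow_left' ?_ 2) (add_sq_le_four_mul _ _)
      rw [hz]
      refine (enorm_add_le _ _).trans (add_le_add ?_ ?_)
      · refine (enorm_integral_le_lintegral_enorm _).trans (le_of_eq ?_)
        simp only [enorm_mul, mul_comm]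
      · refine (enorm_integral_le_lintegral_enorm _).trans (le_of_eq ?_)
        simp only [enorm_mul, mul_comm]
    refine (lintegral_mono_ae hpt).trans ?_
    rw [lintegral_const_mul' _ _ (by norm_num), lintegral_add_left (hm.pow_const 2), mul_assoc,
      add_mul]
    gcongr
    · exact (hk _ hw.enorm).trans (by gcongr)
    · exact (hl _ hW.enorm).trans (by gcongr)
  have hΓ1 := stronglyMeasurable_diffQuot_uncurry d α hΓ
  have hu1 : ∀ᵐ x ∂ν, u x = ∫ y, w y * Γ x y ∂μ
      + ∫ q, W q * diffQuot d α (Γ x) q ∂(μ.prod μ) := by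
    filter_upwards [hu] with x hx
    obtain ⟨h, hx⟩ := hx
    rw [hx, hrep _ h]
  have hum : AEStronglyMeasurable u ν := by
    refine AEStronglyMeasurable.congr ?_ (Filter.EventuallyEq.symm hu1)
    refine (StronglyMeasurable.add ?_ ?_).aestronglyMeasurable
    · exact StronglyMeasurable.integral_prod_right (f := fun x y => w y * Γ x y)
        ((hw.comp_measurable measurable_snd).mul hΓ)
    · exact StronglyMeasurable.integral_prod_right
        (f := fun x q => W q * diffQuot d α (Γ x) q)
        ((hW.comp_measurable measurable_snd).mul hΓ1)
  have n0 : ∫⁻ x, ‖u x‖ₑ ^ 2 ∂ν ≤ A * ENNReal.ofReal (‖φ‖ ^ 2) := by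
    refine bound ν Γ _ u C00 C10 b00 b10 ?_ hu1
    exact Measurable.lintegral_prod_right'
      (f := fun p : E × E => ‖Γ p.1 p.2‖ₑ * ‖w p.2‖ₑ)
      (hΓ.enorm.mul (hw.enorm.comp measurable_snd))
  have hu2 : ∀ᵐ p ∂(ν.prod ν), diffQuot d' s u p
      = ∫ y, w y * diffQuot d' s (fun x => Γ x y) p ∂μ
        + ∫ q, W q * diffQuot d' s (fun x => diffQuot d α (Γ x) q) p ∂(μ.prod μ) := by
    filter_upwards [Measure.quasiMeasurePreserving_fst.ae hu,
      Measure.quasiMeasurePreserving_snd.ae hu] with p hx hy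
    obtain ⟨h, hx⟩ := hx
    obtain ⟨h', hy⟩ := hy
    have i1 : Integrable (fun y => w y * Γ p.1 y) μ := hw2.integrable_mul h.1
    have i2 : Integrable (fun y => w y * Γ p.2 y) μ := hw2.integrable_mul h'.1
    have i3 : Integrable (fun q => W q * diffQuot d α (Γ p.1) q) (μ.prod μ) :=
      hW2.integrable_mul h.2
    have i4 : Integrable (fun q => W q * diffQuot d α (Γ p.2) q) (μ.prod μ) :=
      hW2.integrable_mul h'.2
    rw [hrep _ h] at hx
    rw [hrep _ h'] at hy
    have lin : ∀ (c : ℝ) (a b b' : 𝕜), a * (c • (b - b')) = c • (a * b - a * b') := fun c a b b' => by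
      rw [mul_smul_comm, mul_sub]
    rw [diffQuot, hx, hy]
    simp only [diffQuot.eq_1 d' s, lin]
    rw [integral_smul, integral_smul, integral_sub i1 i2, integral_sub i3 i4, ← smul_add]
    congr 1
    ring
  have n1 : ∫⁻ p, ‖diffQuot d' s u p‖ₑ ^ 2 ∂(ν.prod ν) ≤ B * ENNReal.ofReal (‖φ‖ ^ 2) := by
    refine bound (ν.prod ν) _ _ _ C01 C11 b01 b11 ?_ hu2
    refine Measurable.lintegral_prod_right'
      (f := fun p : (E × E) × E => ‖diffQuot d' s (fun x => Γ x p.2) p.1‖ₑ * ‖w p.2‖ₑ)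
      (StronglyMeasurable.enorm ?_ |>.mul (hw.enorm.comp measurable_snd))
    have := (stronglyMeasurable_diffQuot_uncurry d' s (Γ := fun Q x => Γ x Q)
      (hΓ.comp_measurable measurable_swap)).comp_measurable measurable_swap
    exact this
  have fin : ∀ {C : ℝ≥0∞}, C ≠ ⊤ → C * ENNReal.ofReal (‖φ‖ ^ 2) < ⊤ := fun hC =>
    ENNReal.mul_lt_top hC.lt_top ENNReal.ofReal_lt_top
  have m0 : MemLp u 2 ν := memLp_two_of_lintegral_lt_top hum (n0.trans_lt (fin hA'))
  have m1 : MemLp (diffQuot d' s u) 2 (ν.prod ν) :=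
    memLp_two_of_lintegral_lt_top (aestronglyMeasurable_diffQuot d' s hum) (n1.trans_lt (fin hB'))
  have hmem : MemFracSobolev ν d' s u := ⟨m0, m1⟩
  refine ⟨hmem, ?_⟩
  have hreal : ∀ {Z : Type _} [MeasurableSpace Z] {ζ : Measure Z} {g : Z → 𝕜} (hg : MemLp g 2 ζ)
      {C : ℝ≥0∞}, C ≠ ⊤ → ∫⁻ z, ‖g z‖ₑ ^ 2 ∂ζ ≤ C * ENNReal.ofReal (‖φ‖ ^ 2) →
      ‖hg.toLp g‖ ^ 2 ≤ C.toReal * ‖φ‖ ^ 2 := by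
    intro Z _ ζ g hg C hC hle
    rw [← ofReal_norm_toLp_sq hg, ← ENNReal.ofReal_toReal hC,
      ← ENNReal.ofReal_mul ENNReal.toReal_nonneg] at hle
    exact (ENNReal.ofReal_le_ofReal_iff (by positivity)).1 hle
  have r0 := hreal m0 hA' n0
  have r1 := hreal m1 hB' n1
  have e : ‖hmem.toSobolev‖ ^ 2
      = ‖m0.toLp u‖ ^ 2 + ‖m1.toLp (diffQuot d' s u)‖ ^ 2 := WithLp.prod_norm_sq_eq_of_L2 _
  have hAr : 0 ≤ A.toReal := ENNReal.toReal_nonneg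
  have hBr : 0 ≤ B.toReal := ENNReal.toReal_nonneg
  refine le_of_sq_le_sq ?_ (by positivity)
  rw [e, mul_pow]
  have : A.toReal + B.toReal ≤ (1 + A.toReal + B.toReal) ^ 2 := by nlinarith
  nlinarith [sq_nonneg ‖φ‖, mul_le_mul_of_nonneg_right this (sq_nonneg ‖φ‖)]

/-- The potential of `φ` is dual to integration of the kernel. -/
theorem integral_mul_eq_dual [IsFiniteMeasure ν] (hΓ : StronglyMeasurable (Function.uncurry Γ))
    (h00 : BoundedKernel ν μ Γ)
    (h10 : BoundedKernel ν (μ.prod μ) fun x p => diffQuot d α (Γ x) p)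
    (φ : FracSobolev 𝕜 μ d α →L[𝕜] 𝕜) {u : E → 𝕜}
    (hu : ∀ᵐ x ∂ν, ∃ h : MemFracSobolev μ d α (Γ x), u x = φ h.toSobolev)
    {F : E → 𝕜} (hF : StronglyMeasurable F) {M : ℝ} (hM : ∀ x, ‖F x‖ ≤ M)
    (hint : ∀ᵐ Q ∂μ, Integrable (fun x => F x * Γ x Q) ν)
    (hψ : MemFracSobolev μ d α fun Q => ∫ x, F x * Γ x Q ∂ν) :
    ∫ x, F x * u x ∂ν = φ hψ.toSobolev := by
  obtain ⟨w, W, hw, hW, hw2, hW2, hwn, hWn, hrep⟩ := exists_dual_rep φ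
  have I0 := h00.integrable hΓ hF hM hw (hwn.trans_lt ENNReal.ofReal_lt_top).ne
  have I1 := h10.integrable (stronglyMeasurable_diffQuot_uncurry d α hΓ) hF hM hW
    (hWn.trans_lt ENNReal.ofReal_lt_top).ne
  have e1 : ∫ x, F x * u x ∂ν = ∫ x, (∫ y, F x * (w y * Γ x y) ∂μ
      + ∫ q, F x * (W q * diffQuot d α (Γ x) q) ∂(μ.prod μ)) ∂ν := by
    refine integral_congr_ae ?_
    filter_upwards [hu] with x hx
    obtain ⟨h, hx⟩ := hx
    rw [hx, hrep _ h, integral_const_mul, integral_const_mul, mul_add]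
  rw [e1, integral_add I0.integral_prod_left I1.integral_prod_left,
    integral_integral_swap (f := fun x y => F x * (w y * Γ x y)) I0,
    integral_integral_swap (f := fun x q => F x * (W q * diffQuot d α (Γ x) q)) I1, hrep]
  congr 1
  · congr 1 with y
    rw [← integral_const_mul]
    congr 1 with x
    ring
  · refine integral_congr_ae ?_
    filter_upwards [Measure.quasiMeasurePreserving_fst.ae hint,
      Measure.quasiMeasurePreserving_snd.ae hint] with q h1 h2
    simp only [diffQuot]
    rw [← integral_sub h1 h2, ← integral_smul, ← integral_const_mul]
    congr 1 with x
    rw [← mul_sub, mul_smul_comm, mul_smul_comm, mul_smul_comm, mul_left_comm]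

end Duality

/-! ### Critical kernels and the weight -/

section KernelBounds

variable {E : Type*} [NormedAddCommGroup E]

/-- The squared difference quotient of `|X| ^ (-β)`, bounded by critical radial kernels at the two
distances from the singularity. -/
theorem sq_diff_quot_le {β d σ : ℝ} (hβ : 0 < β) {X Y : E} (hX : X ≠ 0) (hY : Y ≠ 0) :
    ((‖X - Y‖ ^ ((d + 2 * σ) / 2))⁻¹ * |‖X‖ ^ (-β) - ‖Y‖ ^ (-β)|) ^ 2 ≤
      (1 + β) ^ 2 *
        (‖X‖ ^ (-(2 * β + 2 * σ)) * radialKernel d (2 - 2 * σ) (2 * σ) ‖X - Y‖ ‖X‖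
          + ‖Y‖ ^ (-(2 * β + 2 * σ)) * radialKernel d (2 - 2 * σ) (2 * σ) ‖X - Y‖ ‖Y‖) := by
  have nn : ∀ Z : E, 0 ≤ ‖Z‖ ^ (-(2 * β + 2 * σ)) *
      radialKernel d (2 - 2 * σ) (2 * σ) ‖X - Y‖ ‖Z‖ := fun Z =>
    mul_nonneg (by positivity) (radialKernel_nonneg (norm_nonneg _) (norm_nonneg _))
  rcases eq_or_ne X Y with rfl | hXY
  · rw [sub_self (‖X‖ ^ (-β)), abs_zero, mul_zero, zero_pow two_ne_zero]
    exact mul_nonneg (by positivity) (add_nonneg (nn X) (nn X))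
  have hr : 0 < ‖X - Y‖ := norm_pos_iff.2 (sub_ne_zero.2 hXY)
  have key : ∀ m : ℝ, 0 < m → m ≤ ‖X‖ → m ≤ ‖Y‖ →
      ((‖X - Y‖ ^ ((d + 2 * σ) / 2))⁻¹ * |‖X‖ ^ (-β) - ‖Y‖ ^ (-β)|) ^ 2 ≤
      (1 + β) ^ 2 * (m ^ (-(2 * β + 2 * σ)) * radialKernel d (2 - 2 * σ) (2 * σ) ‖X - Y‖ m) := by
    intro m hm h1 h2
    have e1 : m ^ (-(2 * β + 2 * σ)) = (m ^ (-β)) ^ 2 * m ^ (-(2 * σ)) := by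
      rw [← Real.rpow_natCast, ← Real.rpow_mul hm.le, ← Real.rpow_add hm]
      congr 1; push_cast; ring
    rw [e1, mul_assoc, ← sq_min_div_rpow hr hm, ← mul_pow, ← mul_pow]
    refine pow_le_pow_left₀ (by positivity) ?_ 2
    calc _ ≤ (‖X - Y‖ ^ ((d + 2 * σ) / 2))⁻¹ * ((1 + β) * m ^ (-β) * min 1 (‖X - Y‖ / m)) :=
        mul_le_mul_of_nonneg_left (abs_rpow_norm_sub_le hβ hm h1 h2) (by positivity)
      _ = _ := by ring
  rcases le_total ‖X‖ ‖Y‖ with h | h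
  · exact (key _ (norm_pos_iff.2 hX) le_rfl h).trans
      (mul_le_mul_of_nonneg_left (le_add_of_nonneg_right (nn Y)) (by positivity))
  · exact (key _ (norm_pos_iff.2 hY) h le_rfl).trans
      (mul_le_mul_of_nonneg_left (le_add_of_nonneg_left (nn X)) (by positivity))

/-- The squared second mixed difference quotient of `|X| ^ (-β)`, bounded by critical radial
kernels at the smallest distance `m` from the singularity. -/
theorem exists_sq_second_diff_quot_le [InnerProductSpace ℝ E] {β d d' σ σ' : ℝ} (hβ : 0 < β) :
    ∃ C : ℝ, 0 < C ∧ ∀ (m : ℝ) (X e h : E), 0 < m → m ≤ ‖X‖ → m ≤ ‖X + h‖ → m ≤ ‖X + e‖ →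
      m ≤ ‖X + e + h‖ →
      ((‖e‖ ^ ((d + 2 * σ) / 2))⁻¹ * ((‖h‖ ^ ((d' + 2 * σ') / 2))⁻¹ *
        |‖X‖ ^ (-β) - ‖X + h‖ ^ (-β) - ‖X + e‖ ^ (-β) + ‖X + e + h‖ ^ (-β)|)) ^ 2 ≤
      C * (m ^ (-(2 * β + 2 * σ + 2 * σ')) * radialKernel d' (2 - 2 * σ') (2 * σ') ‖h‖ m
        * radialKernel d (2 - 2 * σ) (2 * σ) ‖e‖ m) := by
  obtain ⟨C, hC, hb⟩ := exists_abs_second_difference_le (E := E) hβ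
  refine ⟨C ^ 2, by positivity, fun m X e h hm h00 h01 h10 h11 => ?_⟩
  have nn : 0 ≤ C ^ 2 * (m ^ (-(2 * β + 2 * σ + 2 * σ')) *
      radialKernel d' (2 - 2 * σ') (2 * σ') ‖h‖ m * radialKernel d (2 - 2 * σ) (2 * σ) ‖e‖ m) :=
    mul_nonneg (by positivity) (mul_nonneg (mul_nonneg (by positivity)
      (radialKernel_nonneg (norm_nonneg _) hm.le)) (radialKernel_nonneg (norm_nonneg _) hm.le))
  rcases eq_or_ne e 0 with rfl | he
  · simpa using nn
  rcases eq_or_ne h 0 with rfl | hh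
  · simpa using nn
  have he' := norm_pos_iff.2 he
  have hh' := norm_pos_iff.2 hh
  have e1 : m ^ (-(2 * β + 2 * σ + 2 * σ'))
      = (m ^ (-β)) ^ 2 * (m ^ (-(2 * σ')) * m ^ (-(2 * σ))) := by
    rw [← Real.rpow_natCast, ← Real.rpow_mul hm.le, ← Real.rpow_add hm, ← Real.rpow_add hm]
    congr 1; push_cast; ring
  have e2 : C ^ 2 * (m ^ (-(2 * β + 2 * σ + 2 * σ')) *
      radialKernel d' (2 - 2 * σ') (2 * σ') ‖h‖ m * radialKernel d (2 - 2 * σ) (2 * σ) ‖e‖ m)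
      = (C * m ^ (-β) * (min 1 (‖h‖ / m) / ‖h‖ ^ ((d' + 2 * σ') / 2))
        * (min 1 (‖e‖ / m) / ‖e‖ ^ ((d + 2 * σ) / 2))) ^ 2 := by
    rw [mul_pow, mul_pow, mul_pow, sq_min_div_rpow hh' hm, sq_min_div_rpow he' hm, e1]
    ring
  rw [e2]
  refine pow_le_pow_left₀ (by positivity) ?_ 2
  calc _ ≤ (‖e‖ ^ ((d + 2 * σ) / 2))⁻¹ * ((‖h‖ ^ ((d' + 2 * σ') / 2))⁻¹ *
        (C * m ^ (-β) * min 1 (‖e‖ / m) * min 1 (‖h‖ / m))) := by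
        gcongr; exact hb m X e h hm h00 h01 h10 h11
    _ = _ := by ring

variable [MeasurableSpace E] [BorelSpace E] [SecondCountableTopology E]

/-- Integrating out the second variable of a radial kernel whose scale depends on the first. -/
theorem lintegral_prod_radialKernel_fst_le {τ σ : Measure E} [SFinite σ] {d p q : ℝ} {C : ℝ≥0∞}
    (hb : ∀ (z : E) (ρ : ℝ), 0 ≤ ρ → ∫⁻ x, ENNReal.ofReal (radialKernel d p q ‖x - z‖ ρ) ∂σ ≤ C)
    {A : E → ℝ≥0∞} (hA : Measurable A) {g : E → ℝ} (hg : Measurable g) (hg0 : ∀ x, 0 ≤ g x) :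
    ∫⁻ z, A z.1 * ENNReal.ofReal (radialKernel d p q ‖z.1 - z.2‖ (g z.1)) ∂(τ.prod σ)
      ≤ (∫⁻ x, A x ∂τ) * C := by
  have hm : Measurable fun z : E × E => A z.1 *
      ENNReal.ofReal (radialKernel d p q ‖z.1 - z.2‖ (g z.1)) := by fun_prop
  rw [lintegral_prod _ hm.aemeasurable, ← lintegral_mul_const _ hA]
  refine lintegral_mono fun x => ?_
  have hm' : Measurable fun y => ENNReal.ofReal (radialKernel d p q ‖x - y‖ (g x)) := by fun_prop
  change ∫⁻ y, A x * ENNReal.ofReal (radialKernel d p q ‖x - y‖ (g x)) ∂σ ≤ A x * C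
  rw [lintegral_const_mul _ hm']
  refine mul_le_mul_right ?_ _
  simp only [norm_sub_rev x]
  exact hb x (g x) (hg0 x)

/-- Integrating out the first variable of a radial kernel whose scale depends on the second. -/
theorem lintegral_prod_radialKernel_snd_le {τ σ : Measure E} [SFinite σ] [SFinite τ] {d p q : ℝ}
    {C : ℝ≥0∞}
    (hb : ∀ (z : E) (ρ : ℝ), 0 ≤ ρ → ∫⁻ x, ENNReal.ofReal (radialKernel d p q ‖x - z‖ ρ) ∂σ ≤ C)
    {A : E → ℝ≥0∞} (hA : Measurable A) {g : E → ℝ} (hg : Measurable g) (hg0 : ∀ x, 0 ≤ g x) :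
    ∫⁻ z, A z.2 * ENNReal.ofReal (radialKernel d p q ‖z.1 - z.2‖ (g z.2)) ∂(σ.prod τ)
      ≤ (∫⁻ x, A x ∂τ) * C := by
  refine le_trans (le_of_eq ?_)
    (lintegral_prod_radialKernel_fst_le (τ := τ) (σ := σ) hb hA hg hg0)
  rw [← lintegral_prod_swap]
  simp only [Prod.fst_swap, Prod.snd_swap, norm_sub_rev]

end KernelBounds

section Potential

variable {n : ℕ}

/-- The situation in which the layer potential is studied: `μ` is a finite, upper regular measure
of dimension `n - 1` on the closed set `S`, while `ν` is a finite, upper regular measure of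
dimension `n` that does not charge `S`; both are carried by the ball of radius `D`. -/
structure IsLayerPair (μ ν : Measure (EuclideanSpace ℝ (Fin n))) (S : Set (EuclideanSpace ℝ (Fin n))) (D : ℝ) : Prop where
  fin_left : IsFiniteMeasure μ
  fin_right : IsFiniteMeasure ν
  reg_left : UpperRegular μ ((n : ℝ) - 1)
  reg_right : UpperRegular ν n
  closed : IsClosed S
  mem : ∀ᵐ Q ∂μ, Q ∈ S
  notMem : ∀ᵐ x ∂ν, x ∉ S
  bdd_left : ∀ᵐ Q ∂μ, ‖Q‖ ≤ D
  bdd_right : ∀ᵐ x ∂ν, ‖x‖ ≤ D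

variable {μ ν : Measure (EuclideanSpace ℝ (Fin n))} {S : Set (EuclideanSpace ℝ (Fin n))} {D : ℝ}

theorem IsLayerPair.lintegral_rpow_left_le (h : IsLayerPair μ ν S D) (hn : 2 ≤ n) {e : ℝ}
    (he : 0 < e + ((n : ℝ) - 1)) (he0 : e ≠ 0) :
    ∃ C : ℝ≥0∞, C ≠ ⊤ ∧ ∀ᵐ x ∂ν, ∫⁻ Q, ENNReal.ofReal (‖x - Q‖ ^ e) ∂μ ≤ C := by
  have hn' : (2 : ℝ) ≤ n := by exact_mod_cast hn
  obtain ⟨C, hC, hb⟩ := h.reg_left.lintegral_rpow_le (by linarith) he he0 (D + D)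
  refine ⟨C, hC, ?_⟩
  filter_upwards [h.bdd_right] with x hx
  simp only [norm_sub_rev x]
  refine hb x ?_
  filter_upwards [h.bdd_left] with Q hQ
  exact (norm_sub_le _ _).trans (add_le_add hQ hx)

theorem IsLayerPair.lintegral_rpow_right_le (h : IsLayerPair μ ν S D) {e : ℝ}
    (he : 0 < e + n) (he0 : e ≠ 0) :
    ∃ C : ℝ≥0∞, C ≠ ⊤ ∧ ∀ Q, ‖Q‖ ≤ D → ∫⁻ x, ENNReal.ofReal (‖x - Q‖ ^ e) ∂ν ≤ C := by
  obtain ⟨C, hC, hb⟩ := h.reg_right.lintegral_rpow_le (by positivity) he he0 (D + D)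
  refine ⟨C, hC, fun Q hQ => hb Q ?_⟩
  filter_upwards [h.bdd_right] with x hx
  exact (norm_sub_le _ _).trans (add_le_add hx hQ)

/-- The potential of `μ` with a kernel slightly more singular than the critical one. It is finite
off `S` and serves as the weight in Schur's test. -/
noncomputable def weight (μ : Measure (EuclideanSpace ℝ (Fin n))) (x : EuclideanSpace ℝ (Fin n)) : ℝ≥0∞ :=
  ∫⁻ Q, ENNReal.ofReal (‖x - Q‖ ^ (1 / 2 - (n : ℝ))) ∂μ

@[fun_prop]
theorem measurable_weight [SFinite μ] : Measurable (weight μ) :=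
  Measurable.lintegral_prod_right' (f := fun p : EuclideanSpace ℝ (Fin n) × EuclideanSpace ℝ (Fin n) =>
    ENNReal.ofReal (‖p.1 - p.2‖ ^ (1 / 2 - (n : ℝ)))) (by fun_prop)

/-- Points off the closed set `S` keep a positive distance from `S`. -/
theorem exists_pos_le_norm_sub (hS : IsClosed S) {x : EuclideanSpace ℝ (Fin n)} (hx : x ∉ S) :
    ∃ δ : ℝ, 0 < δ ∧ ∀ Q ∈ S, δ ≤ ‖x - Q‖ := by
  obtain ⟨δ, hδ, hsub⟩ := Metric.isOpen_iff.1 hS.isOpen_compl x hx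
  refine ⟨δ, hδ, fun Q hQ => ?_⟩
  by_contra! hlt
  exact hsub (by rwa [mem_ball, dist_comm, dist_eq_norm]) hQ

theorem IsLayerPair.weight_ne_top (h : IsLayerPair μ ν S D) (hn : 2 ≤ n) {x : EuclideanSpace ℝ (Fin n)} (hx : x ∉ S) :
    weight μ x ≠ ⊤ := by
  have hn' : (2 : ℝ) ≤ n := by exact_mod_cast hn
  have := h.fin_left
  obtain ⟨δ, hδ, hb⟩ := exists_pos_le_norm_sub h.closed hx
  have hle : weight μ x ≤ ∫⁻ _, ENNReal.ofReal (δ ^ (1 / 2 - (n : ℝ))) ∂μ := by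
    refine lintegral_mono_ae ?_
    filter_upwards [h.mem] with Q hQ
    exact ENNReal.ofReal_le_ofReal (Real.rpow_le_rpow_of_nonpos hδ (hb Q hQ) (by linarith))
  refine (hle.trans_lt ?_).ne
  rw [lintegral_const]
  exact ENNReal.mul_lt_top ENNReal.ofReal_lt_top (measure_lt_top _ _)

theorem IsLayerPair.weight_ne_zero (h : IsLayerPair μ ν S D) (hμ : μ ≠ 0) {x : EuclideanSpace ℝ (Fin n)} (hx : x ∉ S) :
    weight μ x ≠ 0 := by
  intro h0
  rw [weight, lintegral_eq_zero_iff (by fun_prop)] at h0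
  have : ∀ᵐ Q ∂μ, False := by
    filter_upwards [h0, h.mem] with Q h1 hQ
    have hpos : 0 < ‖x - Q‖ := norm_pos_iff.2 (sub_ne_zero.2 fun e => hx (e ▸ hQ))
    have : 0 < ‖x - Q‖ ^ (1 / 2 - (n : ℝ)) := by positivity
    simp only [Pi.zero_apply, ENNReal.ofReal_eq_zero] at h1
    linarith
  exact hμ (by simpa using this)

/-- The weighted measure is upper regular of dimension `n - 1 / 2`: the part of `μ` near a ball
contributes by integrability of the kernel, the far part by its decay. -/
theorem IsLayerPair.upperRegular_withDensity_weight (h : IsLayerPair μ ν S D) (hn : 2 ≤ n) :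
    UpperRegular (ν.withDensity (weight μ)) ((n : ℝ) - 1 / 2) := by
  have hn' : (2 : ℝ) ≤ n := by exact_mod_cast hn
  have := h.fin_left
  have := h.fin_right
  obtain ⟨Cν, hCν, hν⟩ := h.reg_right
  obtain ⟨Cμ, hCμ, hμ⟩ := h.reg_left
  obtain ⟨C₁, hC₁, h₁⟩ := h.reg_right.lintegral_ball_rpow_le (e := 1 / 2 - (n : ℝ)) (by positivity)
    (by linarith) (by linarith)
  obtain ⟨C₂, hC₂, h₂⟩ := h.reg_left.lintegral_radialKernel_le (p := 1) (q := 1 / 2) (by linarith)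
    one_pos (by norm_num)
  set a : ℝ := 1 / 2 - (n : ℝ)
  refine ⟨C₁ * ENNReal.ofReal (3 ^ (1 / 2 : ℝ)) * (Cμ * ENNReal.ofReal (2 ^ ((n : ℝ) - 1)))
    + Cν * ENNReal.ofReal (2⁻¹ ^ a * 2⁻¹ ^ (1 / 2 : ℝ)) * C₂, ?_, fun z r hr => ?_⟩
  · exact ENNReal.add_ne_top.2 ⟨by finiteness, by finiteness⟩
  rw [withDensity_apply _ measurableSet_ball]
  have hm : Measurable fun p : EuclideanSpace ℝ (Fin n) × EuclideanSpace ℝ (Fin n) => ENNReal.ofReal (‖p.1 - p.2‖ ^ a) := by fun_prop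
  have hswap : ∫⁻ x in ball z r, weight μ x ∂ν
      = ∫⁻ Q, ∫⁻ x in ball z r, ENNReal.ofReal (‖x - Q‖ ^ a) ∂ν ∂μ :=
    lintegral_lintegral_swap hm.aemeasurable
  rw [hswap]
  -- the two regimes for the position of `Q` relative to the ball
  have hpt : ∀ Q, ∫⁻ x in ball z r, ENNReal.ofReal (‖x - Q‖ ^ a) ∂ν ≤
      (ball z (2 * r)).indicator
        (fun _ => C₁ * ENNReal.ofReal (3 ^ (1 / 2 : ℝ)) * ENNReal.ofReal (r ^ (1 / 2 : ℝ))) Q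
      + Cν * ENNReal.ofReal (2⁻¹ ^ a * 2⁻¹ ^ (1 / 2 : ℝ)) * ENNReal.ofReal (r ^ ((n : ℝ) - 1 / 2))
        * ENNReal.ofReal (radialKernel ((n : ℝ) - 1) 1 (1 / 2) ‖Q - z‖ (2 * r)) := by
    intro Q
    by_cases hQ : Q ∈ ball z (2 * r)
    · rw [indicator_of_mem hQ]
      refine le_trans ?_ le_self_add
      have hsub : ball z r ⊆ ball Q (3 * r) := by
        refine ball_subset_ball' ?_
        rw [mem_ball, dist_comm] at hQ
        linarith
      refine (lintegral_mono_set hsub).trans ((h₁ Q _ (by positivity)).trans (le_of_eq ?_))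
      rw [show a + n = 1 / 2 by simp only [a]; ring, Real.mul_rpow (by norm_num) hr.le,
        ENNReal.ofReal_mul (by positivity), mul_assoc]
    · rw [indicator_of_notMem hQ, zero_add]
      rw [mem_ball, dist_eq_norm, not_lt] at hQ
      have hτ : 0 < ‖Q - z‖ := by linarith
      have h3 : ∀ x ∈ ball z r, ENNReal.ofReal (‖x - Q‖ ^ a) ≤
          ENNReal.ofReal ((2⁻¹ * ‖Q - z‖) ^ a) := by
        intro x hx
        rw [mem_ball, dist_eq_norm] at hx
        refine ENNReal.ofReal_le_ofReal (Real.rpow_le_rpow_of_nonpos (by positivity) ?_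
          (by simp only [a]; linarith))
        have : ‖Q - z‖ ≤ ‖x - Q‖ + ‖x - z‖ := by
          rw [norm_sub_rev x Q]
          calc ‖Q - z‖ = ‖(Q - x) + (x - z)‖ := by congr 1; abel
            _ ≤ _ := norm_add_le _ _
        linarith
      refine (setLIntegral_mono_ae' measurableSet_ball (ae_of_all _ h3)).trans ?_
      rw [setLIntegral_const]
      refine (mul_le_mul_right (hν z r hr) _).trans (le_of_eq ?_)
      have e1 : (2⁻¹ * ‖Q - z‖) ^ a * r ^ (n : ℝ) = (2⁻¹ ^ a * 2⁻¹ ^ (1 / 2 : ℝ))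
          * r ^ ((n : ℝ) - 1 / 2) * radialKernel ((n : ℝ) - 1) 1 (1 / 2) ‖Q - z‖ (2 * r) := by
        have h4 : (2 * r / ‖Q - z‖) ^ (1 / 2 : ℝ) ≤ (‖Q - z‖ / (2 * r)) ^ (1 : ℝ) :=
          (Real.rpow_le_one (by positivity) ((div_le_one hτ).2 hQ) (by norm_num)).trans
            (Real.one_le_rpow ((one_le_div (by positivity)).2 hQ) zero_le_one)
        rw [radialKernel, min_eq_right h4, Real.div_rpow (by positivity) hτ.le,
          Real.mul_rpow (by norm_num) hτ.le, Real.mul_rpow (by norm_num) hr.le,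
          Real.inv_rpow (x := 2) (by norm_num) (1 / 2 : ℝ)]
        have e2 : r ^ (n : ℝ) = r ^ ((n : ℝ) - 1 / 2) * r ^ (1 / 2 : ℝ) := by
          rw [← Real.rpow_add hr]; congr 1; ring
        have e3 : ‖Q - z‖ ^ a = ‖Q - z‖ ^ (-((n : ℝ) - 1)) / ‖Q - z‖ ^ (1 / 2 : ℝ) := by
          rw [← Real.rpow_sub hτ]; congr 1; simp only [a]; ring
        rw [e2, e3]
        have := (Real.rpow_pos_of_pos (two_pos (α := ℝ)) (1 / 2)).ne'
        field_simp
      calc _ = Cν * ENNReal.ofReal ((2⁻¹ * ‖Q - z‖) ^ a * r ^ (n : ℝ)) := by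
            rw [ENNReal.ofReal_mul (by positivity)]; ring
        _ = _ := by
            rw [e1, ENNReal.ofReal_mul (by positivity), ENNReal.ofReal_mul (by positivity)]
            ring
  refine (lintegral_mono hpt).trans ?_
  rw [lintegral_add_left (measurable_const.indicator measurableSet_ball),
    lintegral_indicator_const measurableSet_ball, lintegral_const_mul' _ _ (by finiteness), add_mul]
  refine add_le_add ?_ ?_
  · refine (mul_le_mul_right (hμ z (2 * r) (by positivity)) _).trans (le_of_eq ?_)
    have e4 : r ^ ((n : ℝ) - 1 / 2) = r ^ (1 / 2 : ℝ) * r ^ ((n : ℝ) - 1) := by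
      rw [← Real.rpow_add hr]; congr 1; ring
    rw [e4, Real.mul_rpow (by norm_num) hr.le, ENNReal.ofReal_mul (by positivity),
      ENNReal.ofReal_mul (by positivity)]
    ring
  · refine (mul_le_mul_right (h₂ z (2 * r) (by positivity)) _).trans (le_of_eq ?_)
    ring

end Potential

/-! ### Boundedness of the four kernels -/

section Kernels

variable {n : ℕ} {𝕜 : Type*} [RCLike 𝕜]

theorem rieszKernel_eq_mul_rpow (κ s : ℝ) (x : EuclideanSpace ℝ (Fin n)) :
    rieszKernel κ s x = κ * ‖x‖ ^ (-((n : ℝ) - 2 * s)) := by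
  rw [rieszKernel, Real.rpow_neg (norm_nonneg _), div_eq_mul_inv]

theorem stronglyMeasurable_rieszKernel {X : Type*} [MeasurableSpace X] (κ s : ℝ)
    {f : X → EuclideanSpace ℝ (Fin n)} (hf : Measurable f) :
    StronglyMeasurable fun x => ((rieszKernel κ s (f x) : ℝ) : 𝕜) := by
  simp only [rieszKernel_eq_mul_rpow]
  refine (RCLike.continuous_ofReal (K := 𝕜)).comp_stronglyMeasurable
    (Measurable.stronglyMeasurable (f := fun x => κ * ‖f x‖ ^ (-((n : ℝ) - 2 * s))) ?_)
  fun_prop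

theorem enorm_sq_eq_ofReal (a : 𝕜) : ‖a‖ₑ ^ 2 = ENNReal.ofReal (‖a‖ ^ 2) := by
  rw [ENNReal.ofReal_pow (norm_nonneg _), ofReal_norm]

theorem norm_rieszKernel_sub_sub {κ : ℝ} (hκ : 0 < κ) (s : ℝ) (X Y : EuclideanSpace ℝ (Fin n)) :
    ‖((rieszKernel κ s X : ℝ) : 𝕜) - ((rieszKernel κ s Y : ℝ) : 𝕜)‖
      = κ * |‖X‖ ^ (-((n : ℝ) - 2 * s)) - ‖Y‖ ^ (-((n : ℝ) - 2 * s))| := by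
  rw [← RCLike.ofReal_sub, RCLike.norm_ofReal, rieszKernel_eq_mul_rpow, rieszKernel_eq_mul_rpow,
    ← mul_sub, abs_mul, abs_of_pos hκ]

/-- The squared difference quotient of the Riesz kernel, bounded at both distances. -/
theorem sq_norm_diffQuot_rieszKernel_le {κ s d σ : ℝ} (hκ : 0 < κ) (hβ : 0 < (n : ℝ) - 2 * s)
    {X Y : EuclideanSpace ℝ (Fin n)} (hX : X ≠ 0) (hY : Y ≠ 0) :
    ‖((‖X - Y‖ ^ ((d + 2 * σ) / 2))⁻¹ : ℝ) •
        (((rieszKernel κ s X : ℝ) : 𝕜) - ((rieszKernel κ s Y : ℝ) : 𝕜))‖ ^ 2 ≤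
      κ ^ 2 * (1 + ((n : ℝ) - 2 * s)) ^ 2 *
        (‖X‖ ^ (-(2 * ((n : ℝ) - 2 * s) + 2 * σ))
            * radialKernel d (2 - 2 * σ) (2 * σ) ‖X - Y‖ ‖X‖
          + ‖Y‖ ^ (-(2 * ((n : ℝ) - 2 * s) + 2 * σ))
            * radialKernel d (2 - 2 * σ) (2 * σ) ‖X - Y‖ ‖Y‖) := by
  rw [norm_smul, norm_rieszKernel_sub_sub hκ, Real.norm_of_nonneg (by positivity), mul_left_comm,
    mul_pow, mul_assoc]
  exact mul_le_mul_of_nonneg_left (sq_diff_quot_le hβ hX hY) (by positivity)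

variable {μ ν : Measure (EuclideanSpace ℝ (Fin n))} {S : Set (EuclideanSpace ℝ (Fin n))} {D : ℝ}
variable {κ s : ℝ}

theorem IsLayerPair.boundedKernel_riesz (h : IsLayerPair μ ν S D) (hn : 2 ≤ n) (hs : 1 / 2 < s)
    (hs' : s < 1) :
    BoundedKernel ν μ fun x Q => ((rieszKernel κ s (x - Q) : ℝ) : 𝕜) := by
  have hn' : (2 : ℝ) ≤ n := by exact_mod_cast hn
  have := h.fin_left
  have := h.fin_right
  set e : ℝ := -((n : ℝ) - 2 * s) with he
  obtain ⟨C₁, hC₁, h₁⟩ := h.lintegral_rpow_right_le (e := e) (by linarith) (by linarith)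
  obtain ⟨C₂, hC₂, h₂⟩ := h.lintegral_rpow_left_le hn (e := e) (by linarith) (by linarith)
  refine boundedKernel_of_sq_le (K₁ := fun x Q => ENNReal.ofReal (κ ^ 2) *
    ENNReal.ofReal (‖x - Q‖ ^ e)) (K₂ := fun x Q => ENNReal.ofReal (‖x - Q‖ ^ e))
    (C₁ := ENNReal.ofReal (κ ^ 2) * C₁) (C₂ := C₂) ?_ ?_ ?_ (by finiteness) hC₂ ?_ h₂
  · simp only [Function.uncurry_def]; fun_prop
  · simp only [Function.uncurry_def]; fun_prop
  · refine ae_of_all _ fun x => ae_of_all _ fun Q => le_of_eq ?_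
    rw [enorm_sq_eq_ofReal, RCLike.norm_ofReal, sq_abs, rieszKernel_eq_mul_rpow,
      ← ENNReal.ofReal_mul (by positivity), ← ENNReal.ofReal_mul (by positivity)]
    congr 1; ring
  · filter_upwards [h.bdd_left] with Q hQ
    rw [lintegral_const_mul' _ _ ENNReal.ofReal_ne_top]
    exact mul_le_mul_right (h₁ Q hQ) _

/-- The Riesz kernel with difference quotients along the boundary. -/
theorem IsLayerPair.boundedKernel_diffQuot_left (h : IsLayerPair μ ν S D) (hn : 2 ≤ n)
    (hs : 1 / 2 < s) (hs' : s < 1) (hκ : 0 < κ) :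
    BoundedKernel ν (μ.prod μ) fun x p => diffQuot ((n : ℝ) - 1) (s - 1 / 2)
      (fun Q => ((rieszKernel κ s (x - Q) : ℝ) : 𝕜)) p := by
  have hn' : (2 : ℝ) ≤ n := by exact_mod_cast hn
  have := h.fin_left
  have := h.fin_right
  set e : ℝ := -(n : ℝ) + s + 1 / 2 with he
  obtain ⟨C₁, hC₁, h₁⟩ := h.lintegral_rpow_right_le (e := e) (by linarith) (by linarith)
  obtain ⟨C₂, hC₂, h₂⟩ := h.lintegral_rpow_left_le hn (e := e) (by linarith) (by linarith)
  obtain ⟨C₃, hC₃, h₃⟩ := h.reg_left.lintegral_radialKernel_le (p := 2 - 2 * (s - 1 / 2))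
    (q := 2 * (s - 1 / 2)) (by linarith) (by linarith) (by linarith)
  set c : ℝ := κ ^ 2 * (1 + ((n : ℝ) - 2 * s)) ^ 2 with hc
  set J : ℝ → ℝ → ℝ :=
    radialKernel ((n : ℝ) - 1) (2 - 2 * (s - 1 / 2)) (2 * (s - 1 / 2)) with hJ
  set K₁ : EuclideanSpace ℝ (Fin n) → EuclideanSpace ℝ (Fin n) × EuclideanSpace ℝ (Fin n) → ℝ≥0∞ :=
    fun x q => ENNReal.ofReal c *
      (ENNReal.ofReal (‖x - q.1‖ ^ e) + ENNReal.ofReal (‖x - q.2‖ ^ e)) with hK₁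
  set K₂ : EuclideanSpace ℝ (Fin n) → EuclideanSpace ℝ (Fin n) × EuclideanSpace ℝ (Fin n) → ℝ≥0∞ :=
    fun x q => ENNReal.ofReal (‖x - q.1‖ ^ e) * ENNReal.ofReal (J ‖q.1 - q.2‖ ‖x - q.1‖)
      + ENNReal.ofReal (‖x - q.2‖ ^ e) * ENNReal.ofReal (J ‖q.1 - q.2‖ ‖x - q.2‖) with hK₂
  refine boundedKernel_of_sq_le (K₁ := K₁) (K₂ := K₂)
    (C₁ := ENNReal.ofReal c * (C₁ + C₁)) (C₂ := C₂ * C₃ + C₂ * C₃) ?_ ?_ ?_ (by finiteness)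
    (by finiteness) ?_ ?_
  · simp only [hK₁, Function.uncurry_def]; fun_prop
  · simp only [hK₂, hJ, Function.uncurry_def]; fun_prop
  · filter_upwards [h.notMem] with x hx
    filter_upwards [Measure.quasiMeasurePreserving_fst.ae h.mem,
      Measure.quasiMeasurePreserving_snd.ae h.mem] with q h1 h2
    have n1 : x - q.1 ≠ 0 := sub_ne_zero.2 fun e => hx (e ▸ h1)
    have n2 : x - q.2 ≠ 0 := sub_ne_zero.2 fun e => hx (e ▸ h2)
    have key := sq_norm_diffQuot_rieszKernel_le (𝕜 := 𝕜) (s := s) (d := (n : ℝ) - 1)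
      (σ := s - 1 / 2) hκ (by linarith) n1 n2
    rw [show x - q.1 - (x - q.2) = -(q.1 - q.2) by abel, norm_neg] at key
    have split : ∀ a : EuclideanSpace ℝ (Fin n), a ≠ 0 →
        ENNReal.ofReal (‖a‖ ^ (-(2 * ((n : ℝ) - 2 * s) + 2 * (s - 1 / 2))) * J ‖q.1 - q.2‖ ‖a‖)
        = ENNReal.ofReal (‖a‖ ^ e) * (ENNReal.ofReal (‖a‖ ^ e)
          * ENNReal.ofReal (J ‖q.1 - q.2‖ ‖a‖)) := fun a ha => by
      rw [← mul_assoc, ← ENNReal.ofReal_mul (by positivity), ← Real.rpow_add (norm_pos_iff.2 ha),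
        ENNReal.ofReal_mul (by positivity)]
      congr 3; simp only [he]; ring
    have nn : ∀ a : EuclideanSpace ℝ (Fin n),
        0 ≤ ‖a‖ ^ (-(2 * ((n : ℝ) - 2 * s) + 2 * (s - 1 / 2))) * J ‖q.1 - q.2‖ ‖a‖ := fun a =>
      mul_nonneg (by positivity) (radialKernel_nonneg (norm_nonneg _) (norm_nonneg _))
    rw [enorm_sq_eq_ofReal]
    refine (ENNReal.ofReal_le_ofReal key).trans ?_
    rw [ENNReal.ofReal_mul (by positivity), ENNReal.ofReal_add (nn _) (nn _), split _ n1,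
      split _ n2]
    simp only [hK₁, hK₂]
    rw [mul_assoc]
    refine mul_le_mul_right ?_ _
    rw [add_mul]
    gcongr
    · exact le_self_add
    · exact le_add_self
  · filter_upwards [Measure.quasiMeasurePreserving_fst.ae h.bdd_left,
      Measure.quasiMeasurePreserving_snd.ae h.bdd_left] with q h1 h2
    rw [lintegral_const_mul' _ _ ENNReal.ofReal_ne_top, lintegral_add_left (by fun_prop)]
    exact mul_le_mul_right (add_le_add (h₁ _ h1) (h₁ _ h2)) _
  · filter_upwards [h₂] with x hx
    simp only [hK₂]
    rw [lintegral_add_left (by simp only [hJ]; fun_prop)]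
    refine add_le_add ?_ ?_
    · exact (lintegral_prod_radialKernel_fst_le h₃ (A := fun Q => ENNReal.ofReal (‖x - Q‖ ^ e))
        (g := fun Q => ‖x - Q‖)
        (by fun_prop) (by fun_prop) fun _ => norm_nonneg _).trans (mul_le_mul_left hx _)
    · exact (lintegral_prod_radialKernel_snd_le h₃ (A := fun Q => ENNReal.ofReal (‖x - Q‖ ^ e))
        (g := fun Q => ‖x - Q‖)
        (by fun_prop) (by fun_prop) fun _ => norm_nonneg _).trans (mul_le_mul_left hx _)

/-- The Riesz kernel with difference quotients in space. -/
theorem IsLayerPair.boundedKernel_diffQuot_right (h : IsLayerPair μ ν S D) (hn : 2 ≤ n)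
    (hs : 1 / 2 < s) (hs' : s < 1) (hκ : 0 < κ) :
    BoundedKernel (ν.prod ν) μ fun p Q => diffQuot (n : ℝ) s
      (fun x => ((rieszKernel κ s (x - Q) : ℝ) : 𝕜)) p := by
  have hn' : (2 : ℝ) ≤ n := by exact_mod_cast hn
  have := h.fin_left
  have := h.fin_right
  set e₁ : ℝ := -(n : ℝ) + s - 1 / 2 with he₁
  set e₂ : ℝ := -(n : ℝ) + s + 1 / 2 with he₂
  obtain ⟨C₁, hC₁, h₁⟩ := h.lintegral_rpow_right_le (e := e₁) (by linarith) (by linarith)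
  obtain ⟨C₂, hC₂, h₂⟩ := h.lintegral_rpow_left_le hn (e := e₂) (by linarith) (by linarith)
  obtain ⟨C₃, hC₃, h₃⟩ := h.reg_right.lintegral_radialKernel_le (p := 2 - 2 * s)
    (q := 2 * s) (by linarith) (by linarith) (by linarith)
  set c : ℝ := κ ^ 2 * (1 + ((n : ℝ) - 2 * s)) ^ 2 with hc
  set J : ℝ → ℝ → ℝ := radialKernel (n : ℝ) (2 - 2 * s) (2 * s) with hJ
  set K₁ : EuclideanSpace ℝ (Fin n) × EuclideanSpace ℝ (Fin n) → EuclideanSpace ℝ (Fin n) → ℝ≥0∞ :=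
    fun p Q => ENNReal.ofReal (‖p.1 - Q‖ ^ e₁) * ENNReal.ofReal (J ‖p.1 - p.2‖ ‖p.1 - Q‖)
      + ENNReal.ofReal (‖p.2 - Q‖ ^ e₁) * ENNReal.ofReal (J ‖p.1 - p.2‖ ‖p.2 - Q‖) with hK₁
  set K₂ : EuclideanSpace ℝ (Fin n) × EuclideanSpace ℝ (Fin n) → EuclideanSpace ℝ (Fin n) → ℝ≥0∞ :=
    fun p Q => ENNReal.ofReal c *
      (ENNReal.ofReal (‖p.1 - Q‖ ^ e₂) + ENNReal.ofReal (‖p.2 - Q‖ ^ e₂)) with hK₂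
  refine boundedKernel_of_sq_le (K₁ := K₁) (K₂ := K₂)
    (C₁ := C₁ * C₃ + C₁ * C₃) (C₂ := ENNReal.ofReal c * (C₂ + C₂)) ?_ ?_ ?_ (by finiteness)
    (by finiteness) ?_ ?_
  · simp only [hK₁, hJ, Function.uncurry_def]; fun_prop
  · simp only [hK₂, Function.uncurry_def]; fun_prop
  · filter_upwards [Measure.quasiMeasurePreserving_fst.ae h.notMem,
      Measure.quasiMeasurePreserving_snd.ae h.notMem] with p h1 h2
    filter_upwards [h.mem] with Q hQ
    have n1 : p.1 - Q ≠ 0 := sub_ne_zero.2 fun e => h1 (e ▸ hQ)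
    have n2 : p.2 - Q ≠ 0 := sub_ne_zero.2 fun e => h2 (e ▸ hQ)
    have key := sq_norm_diffQuot_rieszKernel_le (𝕜 := 𝕜) (s := s) (d := (n : ℝ))
      (σ := s) hκ (by linarith) n1 n2
    rw [show p.1 - Q - (p.2 - Q) = p.1 - p.2 by abel] at key
    have split : ∀ a : EuclideanSpace ℝ (Fin n), a ≠ 0 →
        ENNReal.ofReal (‖a‖ ^ (-(2 * ((n : ℝ) - 2 * s) + 2 * s)) * J ‖p.1 - p.2‖ ‖a‖)
        = (ENNReal.ofReal (‖a‖ ^ e₁) * ENNReal.ofReal (J ‖p.1 - p.2‖ ‖a‖))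
          * ENNReal.ofReal (‖a‖ ^ e₂) := fun a ha => by
      rw [mul_right_comm, ← ENNReal.ofReal_mul (by positivity),
        ← Real.rpow_add (norm_pos_iff.2 ha), ENNReal.ofReal_mul (by positivity)]
      congr 3; simp only [he₁, he₂]; ring
    have nn : ∀ a : EuclideanSpace ℝ (Fin n),
        0 ≤ ‖a‖ ^ (-(2 * ((n : ℝ) - 2 * s) + 2 * s)) * J ‖p.1 - p.2‖ ‖a‖ := fun a =>
      mul_nonneg (by positivity) (radialKernel_nonneg (norm_nonneg _) (norm_nonneg _))
    rw [enorm_sq_eq_ofReal]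
    refine (ENNReal.ofReal_le_ofReal key).trans ?_
    rw [ENNReal.ofReal_mul (by positivity), ENNReal.ofReal_add (nn _) (nn _), split _ n1,
      split _ n2]
    simp only [hK₁, hK₂]
    rw [mul_left_comm]
    refine mul_le_mul_right ?_ _
    rw [add_mul]
    gcongr
    · exact le_self_add
    · exact le_add_self
  · filter_upwards [h.bdd_left] with Q hQ
    simp only [hK₁]
    rw [lintegral_add_left (by simp only [hJ]; fun_prop)]
    refine add_le_add ?_ ?_
    · exact (lintegral_prod_radialKernel_fst_le h₃ (A := fun x => ENNReal.ofReal (‖x - Q‖ ^ e₁))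
        (g := fun x => ‖x - Q‖)
        (by fun_prop) (by fun_prop) fun _ => norm_nonneg _).trans (mul_le_mul_left (h₁ Q hQ) _)
    · exact (lintegral_prod_radialKernel_snd_le h₃ (A := fun x => ENNReal.ofReal (‖x - Q‖ ^ e₁))
        (g := fun x => ‖x - Q‖)
        (by fun_prop) (by fun_prop) fun _ => norm_nonneg _).trans (mul_le_mul_left (h₁ Q hQ) _)
  · filter_upwards [Measure.quasiMeasurePreserving_fst.ae h₂,
      Measure.quasiMeasurePreserving_snd.ae h₂] with p h1 h2
    rw [lintegral_const_mul' _ _ ENNReal.ofReal_ne_top, lintegral_add_left (by fun_prop)]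
    exact mul_le_mul_right (add_le_add h1 h2) _

set_option maxHeartbeats 600000 in
/-- The Riesz kernel with difference quotients in both variables. This is the scale invariant
part of the operator; absolute integrability is restored by the weight, since the boundary has
codimension one. -/
theorem IsLayerPair.boundedKernel_diffQuot_diffQuot (h : IsLayerPair μ ν S D) (hn : 2 ≤ n)
    (hs : 1 / 2 < s) (hs' : s < 1) (hκ : 0 < κ) :
    BoundedKernel (ν.prod ν) (μ.prod μ) fun p q => diffQuot (n : ℝ) s (fun x =>
      diffQuot ((n : ℝ) - 1) (s - 1 / 2) (fun Q => ((rieszKernel κ s (x - Q) : ℝ) : 𝕜)) q) p := by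
  have hn' : (2 : ℝ) ≤ n := by exact_mod_cast hn
  have := h.fin_left
  have := h.fin_right
  rcases eq_or_ne μ 0 with rfl | hμ
  · refine ⟨0, by simp, fun f hf => ?_⟩
    simp
  obtain ⟨C₀, hC₀, hker⟩ := exists_sq_second_diff_quot_le (E := EuclideanSpace ℝ (Fin n))
    (β := (n : ℝ) - 2 * s) (d := n) (d' := (n : ℝ) - 1) (σ := s) (σ' := s - 1 / 2) (by linarith)
  obtain ⟨C₁, hC₁, h₁⟩ := (h.upperRegular_withDensity_weight hn).lintegral_radialKernel_le
    (p := s - 1 / 2) (q := 1 - (s - 1 / 2)) (by linarith) (by linarith) (by linarith)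
  obtain ⟨C₂, hC₂, h₂⟩ := h.reg_left.lintegral_radialKernel_le (p := 1 - (s - 1 / 2))
    (q := s - 1 / 2) (by linarith) (by linarith) (by linarith)
  obtain ⟨C₃, hC₃, h₃⟩ := h.reg_right.lintegral_radialKernel_le (p := 2 - 2 * s)
    (q := 2 * s) (by linarith) (by linarith) (by linarith)
  obtain ⟨c, hc⟩ : ∃ c : ℝ, c = κ ^ 2 * C₀ := ⟨_, rfl⟩
  set J₁ : ℝ → ℝ → ℝ := radialKernel ((n : ℝ) - 1 / 2) (s - 1 / 2) (1 - (s - 1 / 2)) with hJ₁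
  set J₂ : ℝ → ℝ → ℝ := radialKernel ((n : ℝ) - 1) (1 - (s - 1 / 2)) (s - 1 / 2) with hJ₂
  set J₃ : ℝ → ℝ → ℝ := radialKernel (n : ℝ) (2 - 2 * s) (2 * s) with hJ₃
  -- the contribution of the pair `(a, b)`, where `t`, `r` are the increments on the boundary and
  -- in space
  set T₁ : EuclideanSpace ℝ (Fin n) → EuclideanSpace ℝ (Fin n) → ℝ → ℝ → ℝ≥0∞ := fun a b t r =>
    weight μ a * ENNReal.ofReal (J₁ ‖a - b‖ t) * ENNReal.ofReal (J₃ r ‖a - b‖) with hT₁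
  set T₂ : EuclideanSpace ℝ (Fin n) → EuclideanSpace ℝ (Fin n) → ℝ → ℝ≥0∞ := fun a b t =>
    ENNReal.ofReal (‖a - b‖ ^ (1 / 2 - (n : ℝ))) * (weight μ a)⁻¹
      * ENNReal.ofReal (J₂ t ‖a - b‖) with hT₂
  set K₁ : EuclideanSpace ℝ (Fin n) × EuclideanSpace ℝ (Fin n) →
      EuclideanSpace ℝ (Fin n) × EuclideanSpace ℝ (Fin n) → ℝ≥0∞ := fun p q =>
    T₁ p.1 q.1 ‖q.1 - q.2‖ ‖p.1 - p.2‖ + T₁ p.2 q.1 ‖q.1 - q.2‖ ‖p.1 - p.2‖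
      + (T₁ p.1 q.2 ‖q.1 - q.2‖ ‖p.1 - p.2‖ + T₁ p.2 q.2 ‖q.1 - q.2‖ ‖p.1 - p.2‖) with hK₁
  set K₂ : EuclideanSpace ℝ (Fin n) × EuclideanSpace ℝ (Fin n) →
      EuclideanSpace ℝ (Fin n) × EuclideanSpace ℝ (Fin n) → ℝ≥0∞ := fun p q =>
    ENNReal.ofReal c * (T₂ p.1 q.1 ‖q.1 - q.2‖ + T₂ p.1 q.2 ‖q.1 - q.2‖
      + (T₂ p.2 q.1 ‖q.1 - q.2‖ + T₂ p.2 q.2 ‖q.1 - q.2‖)) with hK₂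
  -- integrals of a single contribution
  have i₁ : ∀ (b : EuclideanSpace ℝ (Fin n)) (t : ℝ), 0 ≤ t →
      ∫⁻ x, weight μ x * ENNReal.ofReal (J₁ ‖x - b‖ t) ∂ν ≤ C₁ := by
    intro b t ht
    refine le_trans (le_of_eq ?_) (h₁ b t ht)
    rw [lintegral_withDensity_eq_lintegral_mul _ measurable_weight (by fun_prop)]
    rfl
  have i₁₁ : ∀ (b : EuclideanSpace ℝ (Fin n)) (t : ℝ), 0 ≤ t →
      ∫⁻ p, T₁ p.1 b t ‖p.1 - p.2‖ ∂(ν.prod ν) ≤ C₁ * C₃ := fun b t ht =>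
    (lintegral_prod_radialKernel_fst_le h₃
      (A := fun x => weight μ x * ENNReal.ofReal (J₁ ‖x - b‖ t)) (g := fun x => ‖x - b‖) (by simp only [hJ₁]; fun_prop)
      (by fun_prop) fun _ => norm_nonneg _).trans (mul_le_mul_left (i₁ b t ht) _)
  have i₁₂ : ∀ (b : EuclideanSpace ℝ (Fin n)) (t : ℝ), 0 ≤ t →
      ∫⁻ p, T₁ p.2 b t ‖p.1 - p.2‖ ∂(ν.prod ν) ≤ C₁ * C₃ := fun b t ht =>
    (lintegral_prod_radialKernel_snd_le h₃
      (A := fun x => weight μ x * ENNReal.ofReal (J₁ ‖x - b‖ t)) (g := fun x => ‖x - b‖) (by simp only [hJ₁]; fun_prop)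
      (by fun_prop) fun _ => norm_nonneg _).trans (mul_le_mul_left (i₁ b t ht) _)
  have i₂ : ∀ a : EuclideanSpace ℝ (Fin n),
      ∫⁻ Q, ENNReal.ofReal (‖a - Q‖ ^ (1 / 2 - (n : ℝ))) * (weight μ a)⁻¹ ∂μ ≤ 1 := by
    intro a
    rw [lintegral_mul_const _ (by fun_prop)]
    exact ENNReal.mul_inv_le_one _
  have i₂₁ : ∀ a : EuclideanSpace ℝ (Fin n),
      ∫⁻ q, T₂ a q.1 ‖q.1 - q.2‖ ∂(μ.prod μ) ≤ 1 * C₂ := fun a =>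
    (lintegral_prod_radialKernel_fst_le h₂
      (A := fun Q => ENNReal.ofReal (‖a - Q‖ ^ (1 / 2 - (n : ℝ))) * (weight μ a)⁻¹)
      (g := fun Q => ‖a - Q‖) (by fun_prop) (by fun_prop) fun _ => norm_nonneg _).trans (mul_le_mul_left (i₂ a) _)
  have i₂₂ : ∀ a : EuclideanSpace ℝ (Fin n),
      ∫⁻ q, T₂ a q.2 ‖q.1 - q.2‖ ∂(μ.prod μ) ≤ 1 * C₂ := fun a =>
    (lintegral_prod_radialKernel_snd_le h₂
      (A := fun Q => ENNReal.ofReal (‖a - Q‖ ^ (1 / 2 - (n : ℝ))) * (weight μ a)⁻¹)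
      (g := fun Q => ‖a - Q‖) (by fun_prop) (by fun_prop) fun _ => norm_nonneg _).trans (mul_le_mul_left (i₂ a) _)
  refine boundedKernel_of_sq_le (K₁ := K₁) (K₂ := K₂)
    (C₁ := C₁ * C₃ + C₁ * C₃ + (C₁ * C₃ + C₁ * C₃))
    (C₂ := ENNReal.ofReal c * (1 * C₂ + 1 * C₂ + (1 * C₂ + 1 * C₂))) ?_ ?_ ?_ (by finiteness)
    (by finiteness) ?_ ?_
  · simp only [hK₁, hT₁, hJ₁, hJ₃, Function.uncurry_def]; fun_prop
  · simp only [hK₂, hT₂, hJ₂, Function.uncurry_def]; fun_prop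
  · filter_upwards [Measure.quasiMeasurePreserving_fst.ae h.notMem,
      Measure.quasiMeasurePreserving_snd.ae h.notMem] with p hp1 hp2
    filter_upwards [Measure.quasiMeasurePreserving_fst.ae h.mem,
      Measure.quasiMeasurePreserving_snd.ae h.mem] with q hq1 hq2
    set L : 𝕜 := diffQuot (n : ℝ) s (fun x => diffQuot ((n : ℝ) - 1) (s - 1 / 2)
      (fun Q => ((rieszKernel κ s (x - Q) : ℝ) : 𝕜)) q) p with hL
    have hnorm : ‖L‖ = κ * ((‖p.2 - p.1‖ ^ (((n : ℝ) + 2 * s) / 2))⁻¹ *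
        ((‖q.1 - q.2‖ ^ (((n : ℝ) - 1 + 2 * (s - 1 / 2)) / 2))⁻¹ *
        |‖p.1 - q.1‖ ^ (-((n : ℝ) - 2 * s)) - ‖p.1 - q.1 + (q.1 - q.2)‖ ^ (-((n : ℝ) - 2 * s))
          - ‖p.1 - q.1 + (p.2 - p.1)‖ ^ (-((n : ℝ) - 2 * s))
          + ‖p.1 - q.1 + (p.2 - p.1) + (q.1 - q.2)‖ ^ (-((n : ℝ) - 2 * s))|)) := by
      rw [show p.1 - q.1 + (q.1 - q.2) = p.1 - q.2 by abel,
        show p.1 - q.1 + (p.2 - p.1) = p.2 - q.1 by abel,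
        show p.2 - q.1 + (q.1 - q.2) = p.2 - q.2 by abel, norm_sub_rev p.2 p.1]
      simp only [hL, diffQuot]
      rw [← smul_sub, norm_smul, norm_smul, Real.norm_of_nonneg (by positivity),
        Real.norm_of_nonneg (by positivity), ← RCLike.ofReal_sub, ← RCLike.ofReal_sub,
        ← RCLike.ofReal_sub, RCLike.norm_ofReal]
      simp only [rieszKernel_eq_mul_rpow]
      rw [show ∀ a b c d : ℝ, κ * a - κ * b - (κ * c - κ * d) = κ * (a - b - c + d) by
        intros; ring, abs_mul, abs_of_pos hκ]
      ring
    -- the bound at the smallest of the four distances splits into the two contributions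
    have hmin : ∀ a b : EuclideanSpace ℝ (Fin n), a ∉ S → b ∈ S → ‖a - b‖ ≤ ‖p.1 - q.1‖ →
        ‖a - b‖ ≤ ‖p.1 - q.2‖ → ‖a - b‖ ≤ ‖p.2 - q.1‖ → ‖a - b‖ ≤ ‖p.2 - q.2‖ →
        ‖L‖ₑ ^ 2 ≤ T₁ a b ‖q.1 - q.2‖ ‖p.1 - p.2‖ * (ENNReal.ofReal c * T₂ a b ‖q.1 - q.2‖) := by
      intro a b ha hb h11 h12 h21 h22
      have hab : 0 < ‖a - b‖ := norm_pos_iff.2 (sub_ne_zero.2 fun e => ha (e ▸ hb))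
      have hw : weight μ a * (weight μ a)⁻¹ = 1 :=
        ENNReal.mul_inv_cancel (h.weight_ne_zero hμ ha) (h.weight_ne_top hn ha)
      have k1 := hker ‖a - b‖ (p.1 - q.1) (p.2 - p.1) (q.1 - q.2) hab h11
        (by rwa [show p.1 - q.1 + (q.1 - q.2) = p.1 - q.2 by abel])
        (by rwa [show p.1 - q.1 + (p.2 - p.1) = p.2 - q.1 by abel])
        (by rwa [show p.1 - q.1 + (p.2 - p.1) + (q.1 - q.2) = p.2 - q.2 by abel])
      have k2 : ‖L‖ ^ 2 ≤ c * (‖a - b‖ ^ (1 / 2 - (n : ℝ)) * J₂ ‖q.1 - q.2‖ ‖a - b‖ *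
          (J₁ ‖a - b‖ ‖q.1 - q.2‖ * J₃ ‖p.1 - p.2‖ ‖a - b‖)) := by
        rw [hnorm, mul_pow, hc, mul_assoc]
        refine mul_le_mul_of_nonneg_left (k1.trans (le_of_eq ?_)) (by positivity)
        congr 1
        rw [norm_sub_rev p.2 p.1]
        rcases (norm_nonneg (q.1 - q.2)).eq_or_lt with ht | ht
        · rw [← ht]
          have z1 : radialKernel ((n : ℝ) - 1) (2 - 2 * (s - 1 / 2)) (2 * (s - 1 / 2)) 0 ‖a - b‖
              = 0 := by
            rw [radialKernel, Real.zero_rpow (by linarith), zero_mul]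
          have z2 : J₂ 0 ‖a - b‖ = 0 := by
            rw [hJ₂, radialKernel, Real.zero_rpow (by linarith), zero_mul]
          rw [z1, z2]; ring
        · have e1 := radialKernel_eq_mul (d := (n : ℝ) - 1) (d' := (n : ℝ) - 1 / 2)
            (p := 1 - (s - 1 / 2)) (q := s - 1 / 2) ht hab
          rw [show 2 * (1 - (s - 1 / 2)) = 2 - 2 * (s - 1 / 2) by ring] at e1
          have e2 : ‖a - b‖ ^ (1 / 2 - (n : ℝ))
              = ‖a - b‖ ^ (-(2 * ((n : ℝ) - 2 * s) + 2 * s + 2 * (s - 1 / 2)))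
                * ‖a - b‖ ^ ((n : ℝ) - 1 / 2) := by
            rw [← Real.rpow_add hab]; congr 1; ring
          rw [e1, e2]
          simp only [hJ₁, hJ₂, hJ₃]
          ring
      rw [enorm_sq_eq_ofReal]
      refine (ENNReal.ofReal_le_ofReal k2).trans (le_of_eq ?_)
      have nn₁ : 0 ≤ J₁ ‖a - b‖ ‖q.1 - q.2‖ :=
        radialKernel_nonneg (norm_nonneg _) (norm_nonneg _)
      have nn₂ : 0 ≤ J₂ ‖q.1 - q.2‖ ‖a - b‖ :=
        radialKernel_nonneg (norm_nonneg _) (norm_nonneg _)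
      have hc0 : 0 ≤ c := by rw [hc]; positivity
      rw [ENNReal.ofReal_mul hc0, ENNReal.ofReal_mul (by positivity),
        ENNReal.ofReal_mul (by positivity), ENNReal.ofReal_mul nn₁]
      simp only [hT₁, hT₂]
      calc _ = (weight μ a * (weight μ a)⁻¹) * (ENNReal.ofReal c *
            (ENNReal.ofReal (‖a - b‖ ^ (1 / 2 - (n : ℝ))) *
              ENNReal.ofReal (J₂ ‖q.1 - q.2‖ ‖a - b‖) *
            (ENNReal.ofReal (J₁ ‖a - b‖ ‖q.1 - q.2‖) *
              ENNReal.ofReal (J₃ ‖p.1 - p.2‖ ‖a - b‖)))) := by rw [hw, one_mul]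
        _ = _ := by ring
    have up : ∀ a b : EuclideanSpace ℝ (Fin n), (a = p.1 ∨ a = p.2) → (b = q.1 ∨ b = q.2) →
        T₁ a b ‖q.1 - q.2‖ ‖p.1 - p.2‖ * (ENNReal.ofReal c * T₂ a b ‖q.1 - q.2‖)
          ≤ K₁ p q * K₂ p q := by
      intro a b ha hb
      refine mul_le_mul' ?_ (mul_le_mul_right ?_ _)
      · rcases ha with rfl | rfl <;> rcases hb with rfl | rfl
        · exact le_self_add.trans le_self_add
        · exact le_self_add.trans le_add_self
        · exact le_add_self.trans le_self_add
        · exact le_add_self.trans le_add_self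
      · rcases ha with rfl | rfl <;> rcases hb with rfl | rfl
        · exact le_self_add.trans le_self_add
        · exact le_add_self.trans le_self_add
        · exact le_self_add.trans le_add_self
        · exact le_add_self.trans le_add_self
    have l1 := le_total ‖p.1 - q.1‖ ‖p.1 - q.2‖
    have l2 := le_total ‖p.2 - q.1‖ ‖p.2 - q.2‖
    have fin : ∀ a b : EuclideanSpace ℝ (Fin n), (a = p.1 ∨ a = p.2) → (b = q.1 ∨ b = q.2) →
        ‖a - b‖ ≤ ‖p.1 - q.1‖ → ‖a - b‖ ≤ ‖p.1 - q.2‖ → ‖a - b‖ ≤ ‖p.2 - q.1‖ →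
        ‖a - b‖ ≤ ‖p.2 - q.2‖ → ‖L‖ₑ ^ 2 ≤ K₁ p q * K₂ p q := by
      intro a b ha hb h11 h12 h21 h22
      refine (hmin a b ?_ ?_ h11 h12 h21 h22).trans (up a b ha hb)
      · rcases ha with rfl | rfl <;> assumption
      · rcases hb with rfl | rfl <;> assumption
    rcases l1 with l1 | l1 <;> rcases l2 with l2 | l2
    · rcases le_total ‖p.1 - q.1‖ ‖p.2 - q.1‖ with l3 | l3
      · exact fin p.1 q.1 (.inl rfl) (.inl rfl) le_rfl l1 l3 (l3.trans l2)
      · exact fin p.2 q.1 (.inr rfl) (.inl rfl) l3 (l3.trans l1) le_rfl l2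
    · rcases le_total ‖p.1 - q.1‖ ‖p.2 - q.2‖ with l3 | l3
      · exact fin p.1 q.1 (.inl rfl) (.inl rfl) le_rfl l1 (l3.trans l2) l3
      · exact fin p.2 q.2 (.inr rfl) (.inr rfl) l3 (l3.trans l1) l2 le_rfl
    · rcases le_total ‖p.1 - q.2‖ ‖p.2 - q.1‖ with l3 | l3
      · exact fin p.1 q.2 (.inl rfl) (.inr rfl) l1 le_rfl l3 (l3.trans l2)
      · exact fin p.2 q.1 (.inr rfl) (.inl rfl) (l3.trans l1) l3 le_rfl l2
    · rcases le_total ‖p.1 - q.2‖ ‖p.2 - q.2‖ with l3 | l3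
      · exact fin p.1 q.2 (.inl rfl) (.inr rfl) l1 le_rfl (l3.trans l2) l3
      · exact fin p.2 q.2 (.inr rfl) (.inr rfl) (l3.trans l1) l3 l2 le_rfl
  · refine ae_of_all _ fun q => ?_
    have m1 : ∀ b, Measurable fun p : EuclideanSpace ℝ (Fin n) × EuclideanSpace ℝ (Fin n) =>
        T₁ p.1 b ‖q.1 - q.2‖ ‖p.1 - p.2‖ := fun b => by
      simp only [hT₁, hJ₁, hJ₃]; fun_prop
    have m2 : ∀ b, Measurable fun p : EuclideanSpace ℝ (Fin n) × EuclideanSpace ℝ (Fin n) =>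
        T₁ p.2 b ‖q.1 - q.2‖ ‖p.1 - p.2‖ := fun b => by
      simp only [hT₁, hJ₁, hJ₃]; fun_prop
    have m3 : ∀ b, Measurable fun p : EuclideanSpace ℝ (Fin n) × EuclideanSpace ℝ (Fin n) =>
        T₁ p.1 b ‖q.1 - q.2‖ ‖p.1 - p.2‖ + T₁ p.2 b ‖q.1 - q.2‖ ‖p.1 - p.2‖ := fun b =>
      (m1 b).add (m2 b)
    simp only [hK₁]
    rw [lintegral_add_left (m3 _), lintegral_add_left (m1 _),
      lintegral_add_left (m1 _)]
    exact add_le_add (add_le_add (i₁₁ _ _ (norm_nonneg _)) (i₁₂ _ _ (norm_nonneg _)))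
      (add_le_add (i₁₁ _ _ (norm_nonneg _)) (i₁₂ _ _ (norm_nonneg _)))
  · refine ae_of_all _ fun p => ?_
    have m1 : ∀ a, Measurable fun q : EuclideanSpace ℝ (Fin n) × EuclideanSpace ℝ (Fin n) =>
        T₂ a q.1 ‖q.1 - q.2‖ := fun a => by
      simp only [hT₂, hJ₂]; fun_prop
    have m2 : ∀ a, Measurable fun q : EuclideanSpace ℝ (Fin n) × EuclideanSpace ℝ (Fin n) =>
        T₂ a q.2 ‖q.1 - q.2‖ := fun a => by
      simp only [hT₂, hJ₂]; fun_prop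
    have m3 : ∀ a, Measurable fun q : EuclideanSpace ℝ (Fin n) × EuclideanSpace ℝ (Fin n) =>
        T₂ a q.1 ‖q.1 - q.2‖ + T₂ a q.2 ‖q.1 - q.2‖ := fun a => (m1 a).add (m2 a)
    simp only [hK₂]
    rw [lintegral_const_mul' _ _ ENNReal.ofReal_ne_top, lintegral_add_left (m3 _),
      lintegral_add_left (m1 _), lintegral_add_left (m1 _)]
    exact mul_le_mul_right (add_le_add (add_le_add (i₂₁ _) (i₂₂ _))
      (add_le_add (i₂₁ _) (i₂₂ _))) _

end Kernels

/-! ### The layer potential of a Lipschitz domain -/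

section Membership

variable {n : ℕ} {𝕜 : Type*} [RCLike 𝕜]
variable {μ ν : Measure (EuclideanSpace ℝ (Fin n))} {S : Set (EuclideanSpace ℝ (Fin n))} {D : ℝ}
variable {κ s : ℝ}

/-- Bounded Lipschitz functions on `S` belong to `H^(s - 1/2)`. -/
theorem IsLayerPair.memFracSobolev_of_lipschitz (h : IsLayerPair μ ν S D) (hn : 2 ≤ n)
    (hs : 1 / 2 < s) (hs' : s < 1) {g : EuclideanSpace ℝ (Fin n) → 𝕜} (hg : StronglyMeasurable g)
    {M L : ℝ} (hM : ∀ Q ∈ S, ‖g Q‖ ≤ M) (hL : ∀ P ∈ S, ∀ Q ∈ S, ‖g P - g Q‖ ≤ L * ‖P - Q‖) :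
    MemFracSobolev μ ((n : ℝ) - 1) (s - 1 / 2) g := by
  have hn' : (2 : ℝ) ≤ n := by exact_mod_cast hn
  have := h.fin_left
  refine ⟨MemLp.of_bound hg.aestronglyMeasurable M (h.mem.mono hM), ?_⟩
  refine memLp_two_of_lintegral_lt_top
    (aestronglyMeasurable_diffQuot _ _ hg.aestronglyMeasurable) ?_
  set e : ℝ := 2 - ((n : ℝ) - 1 + 2 * (s - 1 / 2)) with he
  have he0 : e ≠ 0 := by
    intro h0
    rcases hn.eq_or_lt with rfl | h3
    · norm_num [he] at h0; linarith
    · have : (3 : ℝ) ≤ n := by exact_mod_cast h3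
      linarith
  obtain ⟨C, hC, hb⟩ := h.reg_left.lintegral_rpow_le (e := e) (by linarith) (by linarith) he0
    (D + D)
  have hpt : ∀ᵐ p ∂(μ.prod μ), ‖diffQuot ((n : ℝ) - 1) (s - 1 / 2) g p‖ₑ ^ 2 ≤
      ENNReal.ofReal (L ^ 2) * ENNReal.ofReal (‖p.1 - p.2‖ ^ e) := by
    filter_upwards [Measure.quasiMeasurePreserving_fst.ae h.mem,
      Measure.quasiMeasurePreserving_snd.ae h.mem] with p h1 h2
    rw [enorm_sq_eq_ofReal, ← ENNReal.ofReal_mul (by positivity)]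
    refine ENNReal.ofReal_le_ofReal ?_
    rcases (norm_nonneg (p.1 - p.2)).eq_or_lt with h0 | h0
    · rw [diffQuot, sub_eq_zero.1 (norm_eq_zero.1 h0.symm), sub_self (g p.2), smul_zero, norm_zero,
        zero_pow two_ne_zero]
      positivity
    · have e1 : L ^ 2 * ‖p.1 - p.2‖ ^ e
          = ((‖p.1 - p.2‖ ^ (((n : ℝ) - 1 + 2 * (s - 1 / 2)) / 2))⁻¹ * (L * ‖p.1 - p.2‖)) ^ 2 := by
        rw [he, Real.rpow_sub h0, mul_pow, mul_pow, inv_pow, ← Real.rpow_natCast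
          (‖p.1 - p.2‖ ^ (((n : ℝ) - 1 + 2 * (s - 1 / 2)) / 2)), ← Real.rpow_mul h0.le,
          Real.rpow_two]
        push_cast
        rw [div_mul_cancel₀ _ two_ne_zero]
        ring
      rw [e1, diffQuot, norm_smul, Real.norm_of_nonneg (by positivity)]
      exact pow_le_pow_left₀ (by positivity)
        (mul_le_mul_of_nonneg_left (hL _ h1 _ h2) (by positivity)) 2
  refine (lintegral_mono_ae hpt).trans_lt ?_
  rw [lintegral_const_mul' _ _ ENNReal.ofReal_ne_top]
  refine ENNReal.mul_lt_top ENNReal.ofReal_lt_top ?_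
  have hm : Measurable fun p : EuclideanSpace ℝ (Fin n) × EuclideanSpace ℝ (Fin n) =>
      ENNReal.ofReal (‖p.1 - p.2‖ ^ e) := by fun_prop
  rw [lintegral_prod_symm' _ hm]
  have hle : ∀ᵐ Q ∂μ, ∫⁻ P, ENNReal.ofReal (‖P - Q‖ ^ e) ∂μ ≤ C := by
    filter_upwards [h.bdd_left] with Q hQ
    refine hb Q ?_
    filter_upwards [h.bdd_left] with P hP
    exact (norm_sub_le _ _).trans (add_le_add hP hQ)
  refine (lintegral_mono_ae hle).trans_lt ?_
  rw [lintegral_const]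
  exact ENNReal.mul_lt_top hC.lt_top (measure_lt_top _ _)

/-- Off the boundary the Riesz kernel is a Lipschitz function of the boundary point. -/
theorem IsLayerPair.memFracSobolev_rieszKernel (h : IsLayerPair μ ν S D) (hn : 2 ≤ n)
    (hs : 1 / 2 < s) (hs' : s < 1) (hκ : 0 < κ) {x : EuclideanSpace ℝ (Fin n)} (hx : x ∉ S) :
    MemFracSobolev μ ((n : ℝ) - 1) (s - 1 / 2)
      (fun Q => ((rieszKernel κ s (x - Q) : ℝ) : 𝕜)) := by
  have hn' : (2 : ℝ) ≤ n := by exact_mod_cast hn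
  have hβ : 0 < (n : ℝ) - 2 * s := by linarith
  obtain ⟨δ, hδ, hb⟩ := exists_pos_le_norm_sub h.closed hx
  have hm : StronglyMeasurable fun Q => ((rieszKernel κ s (x - Q) : ℝ) : 𝕜) :=
    stronglyMeasurable_rieszKernel κ s (by fun_prop)
  refine h.memFracSobolev_of_lipschitz hn hs hs' hm
    (M := κ * δ ^ (-((n : ℝ) - 2 * s)))
    (L := κ * ((1 + ((n : ℝ) - 2 * s)) * δ ^ (-((n : ℝ) - 2 * s)) / δ)) (fun Q hQ => ?_)
    fun P hP Q hQ => ?_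
  · rw [RCLike.norm_ofReal, rieszKernel_eq_mul_rpow, abs_of_nonneg (by positivity)]
    exact mul_le_mul_of_nonneg_left
      (Real.rpow_le_rpow_of_nonpos hδ (hb Q hQ) (by linarith)) hκ.le
  · rw [norm_rieszKernel_sub_sub hκ, mul_assoc]
    refine mul_le_mul_of_nonneg_left ?_ hκ.le
    have key := abs_rpow_norm_sub_le hβ hδ (hb P hP) (hb Q hQ)
    rw [show x - P - (x - Q) = -(P - Q) by abel, norm_neg] at key
    calc _ ≤ _ := key
      _ ≤ (1 + ((n : ℝ) - 2 * s)) * δ ^ (-((n : ℝ) - 2 * s)) * (‖P - Q‖ / δ) := by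
        gcongr; exact min_le_right _ _
      _ = _ := by ring

theorem IsLayerPair.integrable_rpow (h : IsLayerPair μ ν S D) {e : ℝ} (he : 0 < e + n)
    (he0 : e ≠ 0) :
    ∃ C : ℝ, ∀ Q, ‖Q‖ ≤ D → Integrable (fun x => ‖x - Q‖ ^ e) ν ∧ ∫ x, ‖x - Q‖ ^ e ∂ν ≤ C := by
  obtain ⟨C, hC, hb⟩ := h.lintegral_rpow_right_le he he0
  refine ⟨C.toReal, fun Q hQ => ?_⟩
  have hm : AEStronglyMeasurable (fun x => ‖x - Q‖ ^ e) ν := by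
    refine Measurable.aestronglyMeasurable ?_
    fun_prop
  have nn : 0 ≤ᵐ[ν] fun x => ‖x - Q‖ ^ e := ae_of_all _ fun x => by positivity
  refine ⟨(lintegral_ofReal_ne_top_iff_integrable hm nn).1 (ne_top_of_le_ne_top hC (hb Q hQ)), ?_⟩
  rw [integral_eq_lintegral_of_nonneg_ae nn hm]
  exact ENNReal.toReal_mono hC (hb Q hQ)

theorem IsLayerPair.integrable_mul_rieszKernel (h : IsLayerPair μ ν S D) (hs : 1 / 2 < s)
    (hβ : 0 < (n : ℝ) - 2 * s) {F : EuclideanSpace ℝ (Fin n) → 𝕜} (hF : StronglyMeasurable F)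
    {M : ℝ} (hM : ∀ x, ‖F x‖ ≤ M) {Q : EuclideanSpace ℝ (Fin n)} (hQ : ‖Q‖ ≤ D) :
    Integrable (fun x => F x * ((rieszKernel κ s (x - Q) : ℝ) : 𝕜)) ν := by
  obtain ⟨C, hC⟩ := h.integrable_rpow (e := -((n : ℝ) - 2 * s)) (by linarith) (by linarith)
  refine Integrable.bdd_mul (c := M) ?_ hF.aestronglyMeasurable (ae_of_all _ hM)
  simp only [rieszKernel_eq_mul_rpow]
  exact ((hC Q hQ).1.const_mul κ).ofReal

/-- The volume potential of a bounded function is a Lipschitz function on the boundary, because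
the gradient of the Riesz kernel is locally integrable. -/
theorem IsLayerPair.memFracSobolev_volumePotential (h : IsLayerPair μ ν S D) (hn : 2 ≤ n)
    (hs : 1 / 2 < s) (hs' : s < 1) (hκ : 0 < κ) (hSD : ∀ Q ∈ S, ‖Q‖ ≤ D)
    {F : EuclideanSpace ℝ (Fin n) → 𝕜} (hF : StronglyMeasurable F) {M : ℝ} (hM : ∀ x, ‖F x‖ ≤ M) :
    MemFracSobolev μ ((n : ℝ) - 1) (s - 1 / 2)
      (fun Q => ∫ x, F x * ((rieszKernel κ s (x - Q) : ℝ) : 𝕜) ∂ν) := by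
  have hn' : (2 : ℝ) ≤ n := by exact_mod_cast hn
  have hβ : 0 < (n : ℝ) - 2 * s := by linarith
  have := h.fin_right
  have hM0 : 0 ≤ M := (norm_nonneg _).trans (hM 0)
  obtain ⟨C, hC⟩ := h.integrable_rpow (e := -((n : ℝ) - 2 * s)) (by linarith) (by linarith)
  obtain ⟨C', hC'⟩ := h.integrable_rpow (e := -((n : ℝ) - 2 * s) - 1) (by linarith) (by linarith)
  have hm : StronglyMeasurable
      fun Q => ∫ x, F x * ((rieszKernel κ s (x - Q) : ℝ) : 𝕜) ∂ν := by
    have h1 : StronglyMeasurable fun p : EuclideanSpace ℝ (Fin n) × EuclideanSpace ℝ (Fin n) =>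
        ((rieszKernel κ s (p.2 - p.1) : ℝ) : 𝕜) :=
      stronglyMeasurable_rieszKernel κ s (by fun_prop)
    have h2 : StronglyMeasurable fun p : EuclideanSpace ℝ (Fin n) × EuclideanSpace ℝ (Fin n) =>
        F p.2 := hF.comp_measurable measurable_snd
    have h3 : StronglyMeasurable fun p : EuclideanSpace ℝ (Fin n) × EuclideanSpace ℝ (Fin n) =>
        F p.2 * ((rieszKernel κ s (p.2 - p.1) : ℝ) : 𝕜) := h2.mul h1
    exact h3.integral_prod_right'
  refine h.memFracSobolev_of_lipschitz hn hs hs' hm (M := M * κ * C)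
    (L := M * κ * (1 + ((n : ℝ) - 2 * s)) * (C' + C')) (fun Q hQ => ?_) fun P hP Q hQ => ?_
  · refine (norm_integral_le_of_norm_le ((hC Q (hSD Q hQ)).1.const_mul (M * κ))
      (ae_of_all _ fun x => ?_)).trans ?_
    · rw [norm_mul, RCLike.norm_ofReal, rieszKernel_eq_mul_rpow, abs_of_nonneg (by positivity),
        mul_assoc M]
      exact mul_le_mul_of_nonneg_right (hM x) (by positivity)
    · rw [integral_const_mul]
      exact mul_le_mul_of_nonneg_left (hC Q (hSD Q hQ)).2 (by positivity)
  · have IP := hC' P (hSD P hP)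
    have IQ := hC' Q (hSD Q hQ)
    rw [← integral_sub (h.integrable_mul_rieszKernel hs hβ hF hM (hSD P hP))
      (h.integrable_mul_rieszKernel hs hβ hF hM (hSD Q hQ))]
    refine (norm_integral_le_of_norm_le ((IP.1.add IQ.1).const_mul
      (M * κ * (1 + ((n : ℝ) - 2 * s)) * ‖P - Q‖)) ?_).trans ?_
    · filter_upwards [h.notMem] with x hx
      have n1 : 0 < ‖x - P‖ := norm_pos_iff.2 (sub_ne_zero.2 fun e => hx (e ▸ hP))
      have n2 : 0 < ‖x - Q‖ := norm_pos_iff.2 (sub_ne_zero.2 fun e => hx (e ▸ hQ))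
      rw [← mul_sub, norm_mul, norm_rieszKernel_sub_sub hκ]
      have key : |‖x - P‖ ^ (-((n : ℝ) - 2 * s)) - ‖x - Q‖ ^ (-((n : ℝ) - 2 * s))| ≤
          (1 + ((n : ℝ) - 2 * s)) * ‖P - Q‖ * (‖x - P‖ ^ (-((n : ℝ) - 2 * s) - 1)
            + ‖x - Q‖ ^ (-((n : ℝ) - 2 * s) - 1)) := by
        have k : ∀ m : ℝ, 0 < m → m ≤ ‖x - P‖ → m ≤ ‖x - Q‖ →
            |‖x - P‖ ^ (-((n : ℝ) - 2 * s)) - ‖x - Q‖ ^ (-((n : ℝ) - 2 * s))| ≤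
            (1 + ((n : ℝ) - 2 * s)) * ‖P - Q‖ * m ^ (-((n : ℝ) - 2 * s) - 1) := by
          intro m hm h1 h2
          have k1 := abs_rpow_norm_sub_le hβ hm h1 h2
          rw [show x - P - (x - Q) = -(P - Q) by abel, norm_neg] at k1
          calc _ ≤ _ := k1
            _ ≤ (1 + ((n : ℝ) - 2 * s)) * m ^ (-((n : ℝ) - 2 * s)) * (‖P - Q‖ / m) := by
              gcongr; exact min_le_right _ _
            _ = _ := by rw [Real.rpow_sub_one hm.ne']; ring
        rcases le_total ‖x - P‖ ‖x - Q‖ with hle | hle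
        · refine (k _ n1 le_rfl hle).trans (mul_le_mul_of_nonneg_left ?_ (by positivity))
          exact le_add_of_nonneg_right (by positivity)
        · refine (k _ n2 hle le_rfl).trans (mul_le_mul_of_nonneg_left ?_ (by positivity))
          exact le_add_of_nonneg_left (by positivity)
      calc _ ≤ M * (κ * ((1 + ((n : ℝ) - 2 * s)) * ‖P - Q‖ *
            (‖x - P‖ ^ (-((n : ℝ) - 2 * s) - 1) + ‖x - Q‖ ^ (-((n : ℝ) - 2 * s) - 1)))) := by
            gcongr; exact hM x
        _ = _ := by simp only [Pi.add_apply]; ring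
    · rw [integral_const_mul, integral_add' IP.1 IQ.1]
      calc _ ≤ M * κ * (1 + ((n : ℝ) - 2 * s)) * ‖P - Q‖ * (C' + C') := by
            gcongr
            · exact IP.2
            · exact IQ.2
        _ = _ := by ring

/-- The boundary of a Lipschitz domain and Lebesgue measure on a ball. -/
theorem exists_isLayerPair {Ω : Set (EuclideanSpace ℝ (Fin n))} (hΩ : IsBoundedLipschitz Ω)
    (hn : 1 ≤ n) (R : ℝ) :
    ∃ D : ℝ, IsLayerPair (surfaceMeasure Ω) (volume.restrict (ball 0 R)) (frontier Ω) D ∧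
      ∀ Q ∈ frontier Ω, ‖Q‖ ≤ D := by
  obtain ⟨D, hD⟩ := hΩ.isBounded.closure.exists_norm_le
  have hS : ∀ Q ∈ frontier Ω, ‖Q‖ ≤ max D R := fun Q hQ =>
    (hD Q (frontier_subset_closure hQ)).trans (le_max_left _ _)
  refine ⟨max D R, ⟨isFiniteMeasure_surfaceMeasure hΩ hn,
    isFiniteMeasure_restrict.2 measure_ball_lt_top.ne, upperRegular_surfaceMeasure hΩ hn,
    upperRegular_volume.mono Measure.restrict_le_self, isClosed_frontier, ae_mem_frontier_surfaceMeasure Ω,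
    ?_, ?_, ?_⟩, hS⟩
  · exact ae_restrict_of_ae (measure_eq_zero_iff_ae_notMem.1 (volume_frontier hΩ hn))
  · exact (ae_mem_frontier_surfaceMeasure Ω).mono hS
  · filter_upwards [ae_restrict_mem measurableSet_ball] with x hx
    rw [mem_ball_zero_iff] at hx
    exact hx.le.trans (le_max_right _ _)

end Membership

end FracLayer

open FracLayer

theorem mainTheorem4 {𝕜 : Type*} [RCLike 𝕜] (n : ℕ) (hn : 2 ≤ n) (s : ℝ) (hs : 1 / 2 < s)
    (hs' : s < 1) (κ : ℝ) (hκ : 0 < κ) (Ω : Set (EuclideanSpace ℝ (Fin n)))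
    (hΩ : FracLayer.IsBoundedLipschitz Ω) :
    -- the layer potential is well defined off the boundary
    (∀ x ∉ frontier Ω, FracLayer.MemHBdry Ω (s - 1 / 2)
      (fun Q => ((FracLayer.rieszKernel κ s (x - Q) : ℝ) : 𝕜))) ∧
    ∀ R : ℝ, Ω ⊆ ball 0 (R / 2) →
      -- the norm estimate
      (∃ c : ℝ, 0 < c ∧ ∀ φ : FracLayer.HBdryDual 𝕜 Ω (s - 1 / 2),
        ∃ h : FracLayer.MemHOn (ball 0 R) s (FracLayer.layerPotential κ s Ω (s - 1 / 2) φ),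
          ‖h.toSobolev‖ ≤ c * ‖φ‖) ∧
      -- the duality identity
      ∀ φ : FracLayer.HBdryDual 𝕜 Ω (s - 1 / 2), ∀ F : EuclideanSpace ℝ (Fin n) → 𝕜,
        ContDiff ℝ ∞ F → HasCompactSupport F → tsupport F ⊆ ball 0 R →
          IntegrableOn (fun x => F x * FracLayer.layerPotential κ s Ω (s - 1 / 2) φ x)
            (ball 0 R) ∧
          (∀ Q ∈ frontier Ω, IntegrableOn
            (fun x => F x * ((FracLayer.rieszKernel κ s (x - Q) : ℝ) : 𝕜)) (ball 0 R)) ∧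
          ∃ h : FracLayer.MemHBdry Ω (s - 1 / 2)
              (fun Q => ∫ x in ball 0 R, F x * ((FracLayer.rieszKernel κ s (x - Q) : ℝ) : 𝕜)),
            ∫ x in ball 0 R, F x * FracLayer.layerPotential κ s Ω (s - 1 / 2) φ x
              = φ h.toSobolev := by
  have hn1 : 1 ≤ n := by omega
  have hβ : 0 < (n : ℝ) - 2 * s := by
    have : (2 : ℝ) ≤ n := by exact_mod_cast hn
    linarith
  have hmem : ∀ x ∉ frontier Ω, MemHBdry Ω (s - 1 / 2)
      (fun Q => ((rieszKernel κ s (x - Q) : ℝ) : 𝕜)) := fun x hx => by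
    obtain ⟨D, h, -⟩ := exists_isLayerPair hΩ hn1 0
    exact h.memFracSobolev_rieszKernel hn hs hs' hκ hx
  refine ⟨hmem, fun R _ => ?_⟩
  obtain ⟨D, h, hSD⟩ := exists_isLayerPair hΩ hn1 R
  have := h.fin_left
  have := h.fin_right
  have hu : ∀ φ : HBdryDual 𝕜 Ω (s - 1 / 2), ∀ᵐ x ∂(volume.restrict (ball 0 R)),
      ∃ h : MemHBdry Ω (s - 1 / 2) (fun Q => ((rieszKernel κ s (x - Q) : ℝ) : 𝕜)),
        layerPotential κ s Ω (s - 1 / 2) φ x = φ h.toSobolev := fun φ => by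
    filter_upwards [h.notMem] with x hx
    exact ⟨hmem x hx, dif_pos (hmem x hx)⟩
  have hΓ : StronglyMeasurable (Function.uncurry fun x Q : EuclideanSpace ℝ (Fin n) =>
      ((rieszKernel κ s (x - Q) : ℝ) : 𝕜)) := by
    rw [Function.uncurry_def]
    exact stronglyMeasurable_rieszKernel κ s (by fun_prop)
  have h00 := h.boundedKernel_riesz (𝕜 := 𝕜) (κ := κ) hn hs hs'
  have h10 := h.boundedKernel_diffQuot_left (𝕜 := 𝕜) hn hs hs' hκ
  obtain ⟨c, hc, hest⟩ := exists_norm_toSobolev_le hΓ h00 h10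
    (h.boundedKernel_diffQuot_right hn hs hs' hκ) (h.boundedKernel_diffQuot_diffQuot hn hs hs' hκ)
  refine ⟨⟨c, hc, fun φ => hest φ _ (hu φ)⟩, fun φ F hF hFc _ => ?_⟩
  have hFm : StronglyMeasurable F := hF.continuous.stronglyMeasurable
  obtain ⟨M, hM⟩ := hF.continuous.bounded_above_of_compact_support hFc
  obtain ⟨hU, -⟩ := hest φ _ (hu φ)
  have hψ := h.memFracSobolev_volumePotential hn hs hs' hκ hSD hFm hM
  refine ⟨?_, fun Q hQ => h.integrable_mul_rieszKernel hs hβ hFm hM (hSD Q hQ), hψ, ?_⟩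
  · exact Integrable.bdd_mul (c := M) (hU.1.integrable one_le_two) hFm.aestronglyMeasurable
      (ae_of_all _ hM)
  · refine integral_mul_eq_dual hΓ h00 h10 φ (hu φ) hFm hM ?_ hψ
    filter_upwards [h.mem] with Q hQ
    exact h.integrable_mul_rieszKernel hs hβ hFm hM (hSD Q hQ)
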